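/- Let $\kappa>0$ and $D_\kappa=\pi/\sqrt{\kappa}$. Let $(X,d)$ be a complete $\mathrm{CAT}(\kappa)$ space with $d(w,w')<D_\kappa/2$ for all $w,w'\in X$. For $x,y\in X$ and $\alpha\in[0,1]$ let $\alpha x\oplus(1-\alpha)y$ denote the point of the geodesic segment $[x,y]$ at distance $(1-\alpha)d(x,y)$ from $x$. Let $f\colon X\to(-\infty,\infty]$ be proper (finite at some point), lower semicontinuous and convex, that is, $f(\alpha x\oplus(1-\alpha)y)\le\alpha f(x)+(1-\alpha)f(y)$ for all $x,y\in X$ and $\alpha\in(0,1)$. Write $\operatorname{Argmin}_X f$ for the set of minimizers of $f$. Then for every $\eta>0$ and $x\in X$ the function $$y\mapsto f(y)+\frac1\eta\tan\bigl(\sqrt{\kappa}\,d(y,x)\bigr)\sin\bigl(\sqrt{\kappa}\,d(y,x)\bigr)$$ has a unique minimizer in $X$, denoted by $\tilde R_{\eta f}x$. Let $v\in X$, let $\{\alpha_n\}$ be a sequence in $[0,1]$ and $\{\lambda_n\}$ a sequence of positive real numbers with $\lim_n\lambda_n=\infty$, and let $\{y_n\}$ be defined by $y_1\in X$ and $$y_{n+1}=\alpha_n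 v\oplus(1-\alpha_n)\tilde R_{\lambda_n f}y_n\qquad(n=1,2,\dots).$$ Then $\operatorname{Argmin}_X f$ is nonempty if and only if $$\inf_{y\in X}\limsup_{n\to\infty}d(y,\tilde R_{\lambda_n f}y_n)<\frac{D_\kappa}{2}\quad\text{and}\quad\sup_n d(\tilde R_{\lambda_n f}y_n,y_n)<\frac{D_\kappa}{2}.$$ Further, if $\operatorname{Argmin}_X f$ is nonempty, $\lim_n\alpha_n=0$ and $\sum_{n=1}^\infty\alpha_n^2=\infty$, then there is a unique point $Pv$ of $\operatorname{Argmin}_X f$ nearest to $v$ (the metric projection of $v$ onto $\operatorname{Argmin}_X f$), and both $\{y_n\}$ and $\{\tilde R_{\lambda_n f}y_n\}$ converge to $Pv$. -/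

import Mathlib

open Filter Topology

noncomputable section

namespace CATk

/-- The diameter `D_κ = π / √κ` of the model sphere of curvature `κ > 0`. -/
def D (κ : ℝ) : ℝ := Real.pi / Real.sqrt κ

/-- The unit sphere of three-dimensional Euclidean space. -/
abbrev S2 : Type := Metric.sphere (0 : EuclideanSpace ℝ (Fin 3)) 1

/-- The distance of the model space `M_κ`, `κ > 0`: the spherical (angular) distance on the
unit sphere divided by `√κ`. -/
def modelDist (κ : ℝ) (p q : S2) : ℝ :=
  Real.arccos (inner ℝ (p : EuclideanSpace ℝ (Fin 3)) (q : EuclideanSpace ℝ (Fin 3)))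
    / Real.sqrt κ

/-- `c`, restricted to `[0, d x y]`, is a geodesic path from `x` to `y` for the distance
function `d`. -/
def IsGeodesicPath {Y : Type*} (d : Y → Y → ℝ) (x y : Y) (c : ℝ → Y) : Prop :=
  c 0 = x ∧ c (d x y) = y ∧
    ∀ s ∈ Set.Icc 0 (d x y), ∀ t ∈ Set.Icc 0 (d x y), d (c s) (c t) = |s - t|

/-- `S` is a geodesic segment between `x` and `y`: the image of a geodesic path. -/
def IsGeodesicSegment {Y : Type*} (d : Y → Y → ℝ) (x y : Y) (S : Set Y) : Prop :=
  ∃ c : ℝ → Y, IsGeodesicPath d x y c ∧ S = c '' Set.Icc 0 (d x y)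

/-- `x 0, x 1, x 2` and the segments `S i = [x i, x (i + 1)]` (indices modulo 3) form a
geodesic triangle. -/
def IsGeodesicTriangle {Y : Type*} (d : Y → Y → ℝ) (x : Fin 3 → Y) (S : Fin 3 → Set Y) : Prop :=
  ∀ i : Fin 3, IsGeodesicSegment d (x i) (x (i + 1)) (S i)

/-- `q` is a comparison point for `p`: both lie on corresponding sides, at the same distance
from corresponding endpoints.  (As corresponding sides have equal length, it does not matter
from which of the two endpoints the distance is measured.) -/
def IsComparisonPoint {X : Type*} [MetricSpace X] (κ : ℝ) (x : Fin 3 → X) (S : Fin 3 → Set X)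
    (x' : Fin 3 → S2) (S' : Fin 3 → Set S2) (p : X) (q : S2) : Prop :=
  ∃ i : Fin 3, p ∈ S i ∧ q ∈ S' i ∧ dist (x i) p = modelDist κ (x' i) q

/-- `X` is a CAT(κ) space, for `κ > 0`: it is `D_κ`-geodesic, and every geodesic triangle of
perimeter less than `2 D_κ` is no thicker than its comparison triangles in `M_κ`. -/
structure IsCATSpace (κ : ℝ) (X : Type*) [MetricSpace X] : Prop where
  geodesic : ∀ x y : X, dist x y < D κ → ∃ c : ℝ → X, IsGeodesicPath dist x y c
  comparison : ∀ (x : Fin 3 → X) (S : Fin 3 → Set X) (x' : Fin 3 → S2) (S' : Fin 3 → Set S2),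
    dist (x 0) (x 1) + dist (x 1) (x 2) + dist (x 2) (x 0) < 2 * D κ →
    IsGeodesicTriangle dist x S →
    IsGeodesicTriangle (modelDist κ) x' S' →
    (∀ i j : Fin 3, dist (x i) (x j) = modelDist κ (x' i) (x' j)) →
    ∀ (p q : X) (p' q' : S2),
      IsComparisonPoint κ x S x' S' p p' → IsComparisonPoint κ x S x' S' q q' →
      dist p q ≤ modelDist κ p' q'

/-- `z = a x ⊕ (1 - a) y`: the point `c ((1 - a) d(x, y))` of a geodesic path `c` from `x`
to `y`.  (In the spaces considered below the path, hence `z`, is unique.) -/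
def IsGeodesicCombination {X : Type*} [MetricSpace X] (a : ℝ) (x y z : X) : Prop :=
  ∃ c : ℝ → X, IsGeodesicPath dist x y c ∧ z = c ((1 - a) * dist x y)

/-- `f : X → (-∞, ∞]` is proper: never `-∞`, and finite somewhere. -/
def IsProper {X : Type*} (f : X → EReal) : Prop :=
  (∀ x, f x ≠ ⊥) ∧ ∃ a, f a ≠ ⊤

/-- `f (a x ⊕ (1 - a) y) ≤ a f(x) + (1 - a) f(y)` for all `x, y` and `a ∈ (0, 1)`. -/
def IsGeodesicallyConvex {X : Type*} [MetricSpace X] (f : X → EReal) : Prop :=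
  ∀ (x y z : X) (a : ℝ), a ∈ Set.Ioo (0 : ℝ) 1 → IsGeodesicCombination a x y z →
    f z ≤ (a : EReal) * f x + ((1 - a : ℝ) : EReal) * f y

/-- The set of minimizers of `g`. -/
def argmin {X : Type*} (g : X → EReal) : Set X := {x | ∀ y, g x ≤ g y}

/-- The function `y ↦ f(y) + (1/η) tan(√κ d(y, x)) sin(√κ d(y, x))`. -/
def resolventObjective {X : Type*} [MetricSpace X] (κ : ℝ) (f : X → EReal) (η : ℝ) (x : X) :
    X → EReal := fun y =>
  f y + ((1 / η * (Real.tan (Real.sqrt κ * dist y x) * Real.sin (Real.sqrt κ * dist y x)) : ℝ) :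
    EReal)

/-- The resolvent of `η f` at `x`: the minimizer of `resolventObjective κ f η x` (an arbitrary
minimizer if there are several, an arbitrary point if there is none). -/
def resolvent {X : Type*} [MetricSpace X] (κ : ℝ) (f : X → EReal) (η : ℝ) (x : X) : X :=
  @Classical.epsilon X ⟨x⟩ (fun z => z ∈ argmin (resolventObjective κ f η x))

/-- The set of points of `C` nearest to `v`; if it is a singleton `{p}`, then `p` is the metric
projection of `v` onto `C`. -/
def nearestPoints {X : Type*} [MetricSpace X] (C : Set X) (v : X) : Set X :=
  {p | p ∈ C ∧ ∀ q ∈ C, dist v p ≤ dist v q}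

end CATk

end

noncomputable section

namespace CATk

/-! With k = √κ, everything is expressed through the cosines of k·d, which are positive because all
distances are below D_κ/2. Comparison with the sphere becomes one inequality, linear in these
cosines (`SphericalConvexity.le_cos`). At midpoints it plays the role of the parallelogram law, so
completeness yields a substitute for weak compactness: decreasing closed midpoint-convex sets that
all meet one ball have a common point in it (`exists_mem_iInter`). Lower bounds, minimizers and
metric projections all come from this.

Since tan u sin u = 1/cos u - cos u, the penalty of the resolvent is convex with a definite gain at
midpoints, so the resolvent R exists and is unique. Testing its minimality along the segment to a
minimizer p of f gives cos k d(p,x) ≤ cos k d(p,Rx) · cos k d(Rx,x); testing it at midpoints gives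
f(Rx) ≤ f(w) + 4/(cη) whenever c ≤ cos k d(Rx,x). The first estimate bounds the iteration once p
exists. The second makes the resolvents a minimizing sequence as λ_n → ∞, so a minimizer exists as
soon as they eventually stay in a ball of radius below D_κ/2.

For convergence let p = Pv. The resolvents are eventually hardly closer to v than p is, since
otherwise some minimizer would be nearer to v. The comparison inequality on the segment from v to
the resolvent then multiplies the defect max(0, 1 - ε - cos k d(y_n,p)) by at most 1 - α_n²/2, and ∑
α_n² = ∞ drives it to 0 for every ε. -/

/-! ### Great-circle arcs and triangles on the model sphere. -/

theorem cos_modelDist {κ : ℝ} (hκ : 0 < κ) (p q : S2) :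
    Real.cos (Real.sqrt κ * modelDist κ p q)
      = inner ℝ (p : EuclideanSpace ℝ (Fin 3)) (q : EuclideanSpace ℝ (Fin 3)) := by
  have hk : 0 < Real.sqrt κ := Real.sqrt_pos.2 hκ
  have hp : ‖(p : EuclideanSpace ℝ (Fin 3))‖ = 1 := by simp
  have hq : ‖(q : EuclideanSpace ℝ (Fin 3))‖ = 1 := by simp
  have h := abs_le.1 (abs_real_inner_le_norm (p : EuclideanSpace ℝ (Fin 3)) q)
  rw [hp, hq] at h
  unfold modelDist
  rw [mul_div_cancel₀ _ hk.ne', Real.cos_arccos (by linarith) (by linarith)]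

theorem modelDist_eq_of_inner {κ : ℝ} (hκ : 0 < κ) {p q : S2} {t : ℝ} (h0 : 0 ≤ t)
    (hπ : Real.sqrt κ * t ≤ Real.pi)
    (h : inner ℝ (p : EuclideanSpace ℝ (Fin 3)) (q : EuclideanSpace ℝ (Fin 3))
      = Real.cos (Real.sqrt κ * t)) : modelDist κ p q = t := by
  have hk : 0 < Real.sqrt κ := Real.sqrt_pos.2 hκ
  unfold modelDist
  rw [h, Real.arccos_cos (by positivity) hπ, mul_div_cancel_left₀ _ hk.ne']

/-- Two points of the sphere at positive inner product are joined by a great-circle arc, whose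
points are the normalised spherical combinations of the end points. -/
theorem exists_isGeodesicPath_sphere {κ : ℝ} (hκ : 0 < κ) (p q : S2) {L : ℝ} (hL : 0 ≤ L)
    (hLπ : Real.sqrt κ * L < Real.pi)
    (h : inner ℝ (p : EuclideanSpace ℝ (Fin 3)) (q : EuclideanSpace ℝ (Fin 3))
      = Real.cos (Real.sqrt κ * L)) :
    ∃ c : ℝ → S2, IsGeodesicPath (modelDist κ) p q c ∧
      ∀ (t : ℝ) (r : S2),
        inner ℝ (c t : EuclideanSpace ℝ (Fin 3)) (r : EuclideanSpace ℝ (Fin 3))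
            * Real.sin (Real.sqrt κ * L)
          = Real.sin (Real.sqrt κ * (L - t))
              * inner ℝ (p : EuclideanSpace ℝ (Fin 3)) (r : EuclideanSpace ℝ (Fin 3))
            + Real.sin (Real.sqrt κ * t)
              * inner ℝ (q : EuclideanSpace ℝ (Fin 3)) (r : EuclideanSpace ℝ (Fin 3)) := by
  have hk : 0 < Real.sqrt κ := Real.sqrt_pos.2 hκ
  have hd : modelDist κ p q = L := modelDist_eq_of_inner hκ hL hLπ.le h
  have hp : ‖(p : EuclideanSpace ℝ (Fin 3))‖ = 1 := by simp
  have hq : ‖(q : EuclideanSpace ℝ (Fin 3))‖ = 1 := by simp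
  rcases hL.eq_or_lt with rfl | hL
  · have hpq : p = q := by
      apply Subtype.ext
      rw [mul_zero, Real.cos_zero] at h
      exact (inner_eq_one_iff_of_norm_eq_one hp hq).1 h
    subst hpq
    refine ⟨fun _ => p, ⟨rfl, rfl, ?_⟩, ?_⟩
    · intro s hs t ht
      rw [hd, Set.Icc_self] at hs ht
      simp only [Set.mem_singleton_iff] at hs ht
      simp [hs, ht, hd]
    · intro t r
      simp
  · have hs : 0 < Real.sin (Real.sqrt κ * L) :=
      Real.sin_pos_of_pos_of_lt_pi (by positivity) hLπ
    set A := Real.sqrt κ * L with hA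
    set P : EuclideanSpace ℝ (Fin 3) := (p : EuclideanSpace ℝ (Fin 3)) with hP
    set Q : EuclideanSpace ℝ (Fin 3) := (q : EuclideanSpace ℝ (Fin 3)) with hQ
    have hPP : inner ℝ P P = (1 : ℝ) := by rw [real_inner_self_eq_norm_sq, hp]; norm_num
    have hQQ : inner ℝ Q Q = (1 : ℝ) := by rw [real_inner_self_eq_norm_sq, hq]; norm_num
    have hQP : inner ℝ Q P = Real.cos A := by rw [real_inner_comm, h]
    -- Gram–Schmidt: `P`, `e` is an orthonormal basis of the plane of the arc, in which the arc is t
    -- ↦ (cos, sin).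
    set e : EuclideanSpace ℝ (Fin 3) := (Real.sin A)⁻¹ • (Q - Real.cos A • P) with he
    have hPe : inner ℝ P e = (0 : ℝ) := by
      rw [he, inner_smul_right, inner_sub_right, inner_smul_right, h, hPP]; ring
    have heP : inner ℝ e P = (0 : ℝ) := by rw [real_inner_comm, hPe]
    have hee : inner ℝ e e = (1 : ℝ) := by
      rw [he]
      simp only [inner_smul_left, inner_smul_right, inner_sub_left, inner_sub_right, h, hPP, hQQ,
        hQP, conj_trivial]
      field_simp
      have := Real.sin_sq_add_cos_sq A
      linarith
    have hin : ∀ s t : ℝ, inner ℝ (Real.cos s • P + Real.sin s • e)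
        (Real.cos t • P + Real.sin t • e) = Real.cos (s - t) := by
      intro s t
      simp only [inner_add_left, inner_add_right, inner_smul_left, inner_smul_right, hPP, hPe, heP,
        hee, conj_trivial, Real.cos_sub]
      ring
    have hnorm : ∀ s : ℝ, Real.cos s • P + Real.sin s • e ∈
        Metric.sphere (0 : EuclideanSpace ℝ (Fin 3)) 1 := by
      intro s
      have h1 := hin s s
      rw [real_inner_self_eq_norm_sq, sub_self, Real.cos_zero] at h1
      rw [mem_sphere_zero_iff_norm]
      nlinarith [norm_nonneg (Real.cos s • P + Real.sin s • e)]
    refine ⟨fun t => ⟨_, hnorm (Real.sqrt κ * t)⟩, ⟨?_, ?_, ?_⟩, ?_⟩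
    · apply Subtype.ext
      simp [hP]
    · rw [hd]
      apply Subtype.ext
      change Real.cos A • P + Real.sin A • e = Q
      rw [he, smul_smul, mul_inv_cancel₀ hs.ne', one_smul]
      abel
    · intro s hs' t ht'
      rw [hd] at hs' ht'
      have hst : |s - t| ≤ L := abs_le.2 ⟨by linarith [hs'.1, ht'.2], by linarith [hs'.2, ht'.1]⟩
      refine modelDist_eq_of_inner hκ (abs_nonneg _) ?_ ?_
      · exact (mul_le_mul_of_nonneg_left hst hk.le).trans hLπ.le
      · change inner ℝ (Real.cos _ • P + Real.sin _ • e) (Real.cos _ • P + Real.sin _ • e) = _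
        rw [hin, ← mul_sub, ← Real.cos_abs, abs_mul, abs_of_pos hk]
    · intro t r
      change inner ℝ (Real.cos _ • P + Real.sin _ • e) _ * _ = _
      rw [he]
      simp only [inner_add_left, inner_sub_left, inner_smul_left, conj_trivial]
      rw [mul_sub (Real.sqrt κ) L t, ← hA, Real.sin_sub]
      field_simp
      ring

/-- A spherical triangle with prescribed side lengths. -/
theorem exists_comparison_triangle {A B G : ℝ} (hA : 0 < A) (hAπ : A < Real.pi)
    (hG : 0 ≤ G) (hGπ : G ≤ Real.pi) (hB : 0 ≤ B) (h1 : A ≤ B + G) (h2 : G ≤ A + B)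
    (h3 : B ≤ A + G) (h4 : A + G ≤ Real.pi) :
    ∃ x y z : S2,
      inner ℝ (x : EuclideanSpace ℝ (Fin 3)) (y : EuclideanSpace ℝ (Fin 3)) = Real.cos A ∧
      inner ℝ (y : EuclideanSpace ℝ (Fin 3)) (z : EuclideanSpace ℝ (Fin 3)) = Real.cos B ∧
      inner ℝ (z : EuclideanSpace ℝ (Fin 3)) (x : EuclideanSpace ℝ (Fin 3)) = Real.cos G := by
  have hs : 0 < Real.sin A := Real.sin_pos_of_pos_of_lt_pi hA hAπ
  have hsG : 0 ≤ Real.sin G := Real.sin_nonneg_of_nonneg_of_le_pi hG hGπ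
  have hlow : Real.cos (A + G) ≤ Real.cos B :=
    Real.cos_le_cos_of_nonneg_of_le_pi hB h4 h3
  have hup : Real.cos B ≤ Real.cos (A - G) := by
    rw [← Real.cos_abs (A - G)]
    exact Real.cos_le_cos_of_nonneg_of_le_pi (abs_nonneg _) (by linarith)
      (abs_le.2 ⟨by linarith, by linarith⟩)
  rw [Real.cos_add] at hlow
  rw [Real.cos_sub] at hup
  -- With x and y placed in a coordinate plane, the first two coordinates of z are forced by its
  -- inner products; the triangle inequalities give |u| ≤ sin G, which leaves room for a third
  -- coordinate of unit norm.
  set u := (Real.cos B - Real.cos A * Real.cos G) / Real.sin A with hu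
  have hus : u * Real.sin A = Real.cos B - Real.cos A * Real.cos G := by
    rw [hu, div_mul_cancel₀ _ hs.ne']
  have hu1 : u ≤ Real.sin G := by rw [hu, div_le_iff₀ hs]; linarith
  have hu2 : -Real.sin G ≤ u := by rw [hu, le_div_iff₀ hs]; linarith
  have hnn : 0 ≤ Real.sin G ^ 2 - u ^ 2 := by nlinarith
  have hsq := Real.sq_sqrt hnn
  set w := Real.sqrt (Real.sin G ^ 2 - u ^ 2)
  have hA2 := Real.sin_sq_add_cos_sq A
  have hG2 := Real.sin_sq_add_cos_sq G
  refine ⟨⟨!₂[1, 0, 0], ?_⟩, ⟨!₂[Real.cos A, Real.sin A, 0], ?_⟩,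
    ⟨!₂[Real.cos G, u, w], ?_⟩, ?_, ?_, ?_⟩
  · simp [EuclideanSpace.norm_eq, Fin.sum_univ_three]
  · simp [EuclideanSpace.norm_eq, Fin.sum_univ_three]
  · rw [mem_sphere_zero_iff_norm, EuclideanSpace.norm_eq, Real.sqrt_eq_one]
    simp [Fin.sum_univ_three]
    linarith
  · simp [PiLp.inner_apply, Fin.sum_univ_three]
  · simp [PiLp.inner_apply, Fin.sum_univ_three]
    linarith
  · simp [PiLp.inner_apply, Fin.sum_univ_three]

/-! ### The comparison inequality for cosines of distances. -/

variable {X : Type*} [MetricSpace X]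

theorem IsGeodesicCombination.eq_left {a : ℝ} {x y z : X} (h : IsGeodesicCombination a x y z)
    (hxy : dist x y = 0) : z = x := by
  obtain ⟨c, hc, rfl⟩ := h
  rw [hxy, mul_zero, hc.1]

theorem IsGeodesicCombination.dist_left {a : ℝ} {x y z : X} (h : IsGeodesicCombination a x y z)
    (ha : a ∈ Set.Icc (0 : ℝ) 1) : dist x z = (1 - a) * dist x y := by
  obtain ⟨c, hc, rfl⟩ := h
  have h0 := hc.2.2 0 ⟨le_rfl, dist_nonneg⟩ ((1 - a) * dist x y)
    ⟨mul_nonneg (by linarith [ha.2]) dist_nonneg,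
      mul_le_of_le_one_left dist_nonneg (by linarith [ha.1])⟩
  rw [hc.1] at h0
  rw [h0, zero_sub, abs_neg, abs_of_nonneg (mul_nonneg (by linarith [ha.2]) dist_nonneg)]

/-- A geodesic space of diameter less than a quarter of a great circle in which
the cosines of the distances obey the spherical comparison inequality. -/
structure SphericalConvexity (k : ℝ) (X : Type*) [MetricSpace X] : Prop where
  pos : 0 < k
  lt : ∀ x y : X, k * dist x y < Real.pi / 2
  exists_comb : ∀ (a : ℝ) (x y : X), ∃ z, IsGeodesicCombination a x y z
  le_cos : ∀ (a : ℝ) (x y z w : X), a ∈ Set.Icc (0 : ℝ) 1 → IsGeodesicCombination a x y z →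
    Real.cos (k * dist x w) * Real.sin (a * (k * dist x y))
        + Real.cos (k * dist y w) * Real.sin ((1 - a) * (k * dist x y))
      ≤ Real.cos (k * dist z w) * Real.sin (k * dist x y)

/-- On the sphere the inequality is an equality, because the inner product with a fixed vector is a
sine-weighted combination along an arc. Passing from the comparison triangle to X only shortens
d(z,w), hence only raises its cosine. -/
theorem IsCATSpace.sphericalConvexity {κ : ℝ} (hκ : 0 < κ) (hX : IsCATSpace κ X)
    (hdiam : ∀ w w' : X, dist w w' < D κ / 2) : SphericalConvexity (Real.sqrt κ) X := by
  have hk : 0 < Real.sqrt κ := Real.sqrt_pos.2 hκ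
  set k := Real.sqrt κ with hkdef
  have hD : k * D κ = Real.pi := by
    unfold D; rw [mul_div_cancel₀ _ hk.ne']
  have hDpos : 0 < D κ := div_pos Real.pi_pos hk
  have hlt : ∀ x y : X, k * dist x y < Real.pi / 2 := fun x y => by
    have := mul_lt_mul_of_pos_left (hdiam x y) hk
    linarith
  have hgeo : ∀ x y : X, ∃ c : ℝ → X, IsGeodesicPath dist x y c := fun x y =>
    hX.geodesic x y (by linarith [hdiam x y])
  refine ⟨hk, hlt, ?_, ?_⟩
  · intro a x y
    obtain ⟨c, hc⟩ := hgeo x y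
    exact ⟨_, c, hc, rfl⟩
  · intro a x y z w ha hz
    rcases (dist_nonneg (x := x) (y := y)).eq_or_lt with h0 | hpos
    · rw [← h0]; simp
    obtain ⟨c, hc, hzc⟩ := hz
    have nn : ∀ p q : X, 0 ≤ k * dist p q := fun p q => mul_nonneg hk.le dist_nonneg
    have tri : ∀ p q r : X, k * dist p r ≤ k * dist p q + k * dist q r := fun p q r => by
      rw [← mul_add]; exact mul_le_mul_of_nonneg_left (dist_triangle p q r) hk.le
    have sym : ∀ p q : X, k * dist p q = k * dist q p := fun p q => by rw [dist_comm]
    have t1 := tri x w y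
    have t2 := tri w y x
    have t3 := tri y x w
    obtain ⟨x', y', z', hxy, hyz, hzx⟩ := exists_comparison_triangle
      (A := k * dist x y) (B := k * dist y w) (G := k * dist w x) (mul_pos hk hpos)
      (by linarith [hlt x y, Real.pi_pos]) (nn _ _) (by linarith [hlt w x, Real.pi_pos]) (nn _ _)
      (by linarith [sym x w, sym y w]) (by linarith [sym w y, sym x y])
      (by linarith [sym x w, sym x y]) (by linarith [hlt x y, hlt w x])
    have hltπ : ∀ p q : X, k * dist p q < Real.pi := fun p q => by
      linarith [hlt p q, Real.pi_pos]
    obtain ⟨c0, hc0, hform⟩ :=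
      exists_isGeodesicPath_sphere hκ x' y' dist_nonneg (hltπ x y) hxy
    obtain ⟨c1, hc1, -⟩ := exists_isGeodesicPath_sphere hκ y' z' dist_nonneg (hltπ y w) hyz
    obtain ⟨c2, hc2, -⟩ := exists_isGeodesicPath_sphere hκ z' x' dist_nonneg (hltπ w x) hzx
    obtain ⟨g1, hg1⟩ := hgeo y w
    obtain ⟨g2, hg2⟩ := hgeo w x
    have dxy : modelDist κ x' y' = dist x y :=
      modelDist_eq_of_inner hκ dist_nonneg (hltπ x y).le hxy
    have dyz : modelDist κ y' z' = dist y w :=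
      modelDist_eq_of_inner hκ dist_nonneg (hltπ y w).le hyz
    have dzx : modelDist κ z' x' = dist w x :=
      modelDist_eq_of_inner hκ dist_nonneg (hltπ w x).le hzx
    have dsymm : ∀ p q : S2, modelDist κ p q = modelDist κ q p := fun p q => by
      unfold modelDist; rw [real_inner_comm]
    have dself : ∀ p : S2, modelDist κ p p = 0 := fun p => by
      refine modelDist_eq_of_inner hκ le_rfl (by simp [Real.pi_pos.le]) ?_
      have hp : ‖(p : EuclideanSpace ℝ (Fin 3))‖ = 1 := by simp
      rw [real_inner_self_eq_norm_sq, hp]; simp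
    set s := (1 - a) * dist x y with hs
    have hs0 : 0 ≤ s := mul_nonneg (by linarith [ha.2]) dist_nonneg
    have hs1 : s ≤ dist x y := mul_le_of_le_one_left dist_nonneg (by linarith [ha.1])
    -- Only the distance from a point of the side [x, y] to the opposite vertex is compared; that
    -- vertex is the initial point of side 2.
    have hcomp := hX.comparison ![x, y, w]
      ![c '' Set.Icc 0 (dist x y), g1 '' Set.Icc 0 (dist y w), g2 '' Set.Icc 0 (dist w x)]
      ![x', y', z'] ![c0 '' Set.Icc 0 (modelDist κ x' y'), c1 '' Set.Icc 0 (modelDist κ y' z'),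
        c2 '' Set.Icc 0 (modelDist κ z' x')]
      (by
        change dist x y + dist y w + dist w x < 2 * D κ
        linarith [hdiam x y, hdiam y w, hdiam w x])
      (by
        intro i
        fin_cases i
        · exact ⟨c, hc, rfl⟩
        · exact ⟨g1, hg1, rfl⟩
        · exact ⟨g2, hg2, rfl⟩)
      (by
        intro i
        fin_cases i
        · exact ⟨c0, hc0, rfl⟩
        · exact ⟨c1, hc1, rfl⟩
        · exact ⟨c2, hc2, rfl⟩)
      (by
        intro i j
        fin_cases i <;> fin_cases j
        · exact (dist_self x).trans (dself x').symm
        · exact dxy.symm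
        · exact (dist_comm x w).trans (dzx.symm.trans (dsymm _ _))
        · exact (dist_comm y x).trans (dxy.symm.trans (dsymm _ _))
        · exact (dist_self y).trans (dself y').symm
        · exact dyz.symm
        · exact dzx.symm
        · exact (dist_comm w y).trans (dyz.symm.trans (dsymm _ _))
        · exact (dist_self w).trans (dself z').symm)
      z w (c0 s) z'
      (by
        refine ⟨0, ⟨s, ⟨hs0, hs1⟩, hzc.symm⟩, ⟨s, ⟨hs0, by rw [dxy]; exact hs1⟩, rfl⟩, ?_⟩
        change dist x z = modelDist κ x' (c0 s)
        have e1 := hc.2.2 0 ⟨le_rfl, dist_nonneg⟩ s ⟨hs0, hs1⟩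
        have e2 := hc0.2.2 0 ⟨le_rfl, by rw [dxy]; exact dist_nonneg⟩ s
          ⟨hs0, by rw [dxy]; exact hs1⟩
        rw [hc.1, ← hzc] at e1
        rw [hc0.1] at e2
        rw [e1, e2])
      (by
        refine ⟨2, ⟨0, ⟨le_rfl, dist_nonneg⟩, hg2.1⟩,
          ⟨0, ⟨le_rfl, by rw [dzx]; exact dist_nonneg⟩, hc2.1⟩, ?_⟩
        change dist w w = modelDist κ z' z'
        rw [dist_self, dself])
    have hcos : inner ℝ (c0 s : EuclideanSpace ℝ (Fin 3)) (z' : EuclideanSpace ℝ (Fin 3))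
        ≤ Real.cos (k * dist z w) := by
      rw [← cos_modelDist hκ]
      refine Real.cos_le_cos_of_nonneg_of_le_pi (nn _ _) ?_
        (mul_le_mul_of_nonneg_left hcomp hk.le)
      unfold modelDist
      rw [mul_div_cancel₀ _ hk.ne']
      exact Real.arccos_le_pi _
    have hsin : 0 ≤ Real.sin (k * dist x y) :=
      Real.sin_nonneg_of_nonneg_of_le_pi (nn _ _) (hltπ x y).le
    have hf := hform s z'
    rw [hyz, real_inner_comm (z' : EuclideanSpace ℝ (Fin 3)) x', hzx] at hf
    have e1 : k * (dist x y - s) = a * (k * dist x y) := by rw [hs]; ring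
    have e2 : k * s = (1 - a) * (k * dist x y) := by rw [hs]; ring
    rw [← hkdef, e1, e2] at hf
    rw [sym x w]
    nlinarith [mul_le_mul_of_nonneg_right hcos hsin]

/-! ### Midpoint convexity and intersections of closed convex sets. -/

namespace SphericalConvexity

variable {k : ℝ}

theorem nonneg (H : SphericalConvexity k X) (x y : X) : 0 ≤ k * dist x y :=
  mul_nonneg H.pos.le dist_nonneg

theorem cos_pos (H : SphericalConvexity k X) (x y : X) : 0 < Real.cos (k * dist x y) :=
  Real.cos_pos_of_mem_Ioo ⟨by linarith [H.nonneg x y, Real.pi_pos], H.lt x y⟩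

theorem cos_le_cos_iff (H : SphericalConvexity k X) {x y z w : X} :
    Real.cos (k * dist x y) ≤ Real.cos (k * dist z w) ↔ dist z w ≤ dist x y := by
  have := Real.strictAntiOn_cos.le_iff_ge
    (a := k * dist x y) (b := k * dist z w)
    ⟨H.nonneg _ _, by linarith [H.lt x y, Real.pi_pos]⟩
    ⟨H.nonneg _ _, by linarith [H.lt z w, Real.pi_pos]⟩
  rw [this, mul_le_mul_iff_right₀ H.pos]

theorem sq_dist_le (H : SphericalConvexity k X) {x y : X} {b : ℝ}
    (h : 1 - b ≤ Real.cos (k * dist x y)) :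
    dist x y ^ 2 ≤ Real.pi ^ 2 / (2 * k ^ 2) * b := by
  have h1 := Real.cos_le_one_sub_mul_cos_sq (x := k * dist x y)
    (abs_le.2 ⟨by linarith [H.nonneg x y, Real.pi_pos], by linarith [H.lt x y, Real.pi_pos]⟩)
  have h2 : 2 / Real.pi ^ 2 * (k * dist x y) ^ 2 ≤ b := by linarith
  have hk := H.pos
  have hπ := Real.pi_pos
  calc dist x y ^ 2
      = Real.pi ^ 2 / (2 * k ^ 2) * (2 / Real.pi ^ 2 * (k * dist x y) ^ 2) := by field_simp
    _ ≤ _ := mul_le_mul_of_nonneg_left h2 (by positivity)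

theorem sq_dist_le_of_half (H : SphericalConvexity k X) {x y : X} {b : ℝ}
    (h : 1 - b ≤ Real.cos (k * dist x y / 2)) :
    dist x y ^ 2 ≤ 2 * Real.pi ^ 2 / k ^ 2 * b := by
  have h1 := Real.cos_le_one_sub_mul_cos_sq (x := k * dist x y / 2)
    (abs_le.2 ⟨by linarith [H.nonneg x y, Real.pi_pos], by linarith [H.lt x y, H.nonneg x y]⟩)
  have h2 : 2 / Real.pi ^ 2 * (k * dist x y / 2) ^ 2 ≤ b := by linarith
  have hk := H.pos
  have hπ := Real.pi_pos
  calc dist x y ^ 2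
      = 2 * Real.pi ^ 2 / k ^ 2 * (2 / Real.pi ^ 2 * (k * dist x y / 2) ^ 2) := by
        field_simp
    _ ≤ _ := mul_le_mul_of_nonneg_left h2 (by positivity)

theorem eq_of_one_le_cos_half (H : SphericalConvexity k X) {x y : X}
    (h : 1 ≤ Real.cos (k * dist x y / 2)) : x = y := by
  have := H.sq_dist_le_of_half (b := 0) (by simpa using h)
  rw [mul_zero] at this
  exact dist_eq_zero.1 (pow_eq_zero_iff (two_ne_zero)|>.1 (le_antisymm this (sq_nonneg _)))

theorem cos_half_nonneg (H : SphericalConvexity k X) (x y : X) :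
    0 ≤ Real.cos (k * dist x y / 2) :=
  Real.cos_nonneg_of_mem_Icc
    ⟨by linarith [H.nonneg x y, Real.pi_pos], by linarith [H.lt x y, H.nonneg x y]⟩

/-- The analogue of the parallelogram law: if z is hardly closer to w than x and y are, the factor
cos(k d(x,y)/2) must be near 1, so x and y are close. -/
theorem midpoint (H : SphericalConvexity k X) {x y z : X}
    (h : IsGeodesicCombination (1 / 2) x y z) (w : X) :
    Real.cos (k * dist x w) + Real.cos (k * dist y w)
      ≤ 2 * (Real.cos (k * dist z w) * Real.cos (k * dist x y / 2)) := by
  rcases (dist_nonneg (x := x) (y := y)).eq_or_lt with h0 | hpos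
  · rw [h.eq_left h0.symm, ← dist_eq_zero.1 h0.symm]
    simp [two_mul]
  · have hA : 0 < k * dist x y := mul_pos H.pos hpos
    have key := H.le_cos _ x y z w ⟨by norm_num, by norm_num⟩ h
    have e1 : 1 / 2 * (k * dist x y) = k * dist x y / 2 := by ring
    have e2 : (1 - 1 / 2) * (k * dist x y) = k * dist x y / 2 := by ring
    have e3 : Real.sin (k * dist x y)
        = 2 * Real.sin (k * dist x y / 2) * Real.cos (k * dist x y / 2) := by
      rw [← Real.sin_two_mul]; congr 1; ring
    rw [e1, e2, e3] at key
    have hs : 0 < Real.sin (k * dist x y / 2) :=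
      Real.sin_pos_of_pos_of_lt_pi (by linarith) (by linarith [H.lt x y, Real.pi_pos])
    refine le_of_mul_le_mul_right ?_ hs
    linarith

/-- Balls are geodesically convex. -/
theorem le_cos_of_le (H : SphericalConvexity k X) {a : ℝ} (ha : a ∈ Set.Icc (0 : ℝ) 1)
    {x y z w : X} (h : IsGeodesicCombination a x y z) {c : ℝ} (hc : 0 ≤ c)
    (hx : c ≤ Real.cos (k * dist x w)) (hy : c ≤ Real.cos (k * dist y w)) :
    c ≤ Real.cos (k * dist z w) := by
  rcases (dist_nonneg (x := x) (y := y)).eq_or_lt with h0 | hpos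
  · rwa [h.eq_left h0.symm]
  · have hA : 0 < k * dist x y := mul_pos H.pos hpos
    have key := H.le_cos _ x y z w ha h
    have hlt := H.lt x y
    set A := k * dist x y
    have hs : 0 < Real.sin A := Real.sin_pos_of_pos_of_lt_pi hA (by linarith)
    have hs1 : 0 ≤ Real.sin (a * A) := Real.sin_nonneg_of_nonneg_of_le_pi
      (mul_nonneg ha.1 hA.le) (by nlinarith [ha.2])
    have hs2 : 0 ≤ Real.sin ((1 - a) * A) := Real.sin_nonneg_of_nonneg_of_le_pi
      (mul_nonneg (by linarith [ha.2]) hA.le) (by nlinarith [ha.1])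
    -- Subadditivity of sine: the weights in `le_cos` total at least sin A, which suffices because c
    -- ≥ 0.
    have hadd : Real.sin A ≤ Real.sin (a * A) + Real.sin ((1 - a) * A) := by
      have : A = a * A + (1 - a) * A := by ring
      conv_lhs => rw [this, Real.sin_add]
      have h1 := Real.cos_le_one (a * A)
      have h2 := Real.cos_le_one ((1 - a) * A)
      nlinarith
    refine le_of_mul_le_mul_right ?_ hs
    nlinarith

theorem cauchySeq (H : SphericalConvexity k X) {u : ℕ → X} {b : ℕ → ℝ}
    (hb : Tendsto b atTop (𝓝 0))
    (h : ∀ n m, n ≤ m → 1 - b n ≤ Real.cos (k * dist (u n) (u m) / 2)) : CauchySeq u := by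
  refine cauchySeq_of_le_tendsto_0' (fun n => Real.sqrt (2 * Real.pi ^ 2 / k ^ 2 * b n)) ?_ ?_
  · intro n m hnm
    exact Real.le_sqrt_of_sq_le (H.sq_dist_le_of_half (h n m hnm))
  · have := (Real.continuous_sqrt.tendsto _).comp (hb.const_mul (2 * Real.pi ^ 2 / k ^ 2))
    simpa [Function.comp_def] using this

/-- A decreasing sequence of closed, midpoint-convex sets that all meet a fixed ball of radius
less than a quarter of a great circle has a common point; it can be found in every closed ball
about the same centre that meets all the sets. -/
theorem exists_mem_iInter [CompleteSpace X] (H : SphericalConvexity k X) {C : ℕ → Set X}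
    (hanti : Antitone C) (hcl : ∀ n, IsClosed (C n))
    (hconv : ∀ n, ∀ x ∈ C n, ∀ y ∈ C n, ∀ z, IsGeodesicCombination (1 / 2) x y z → z ∈ C n)
    (a : X) {r : ℝ} (hr : 0 < r) (hmeet : ∀ n, ∃ q ∈ C n, r ≤ Real.cos (k * dist q a)) :
    ∃ p, (∀ n, p ∈ C n) ∧
      ∀ s, (∀ n, ∃ q ∈ C n, s ≤ Real.cos (k * dist q a)) → s ≤ Real.cos (k * dist p a) := by
  -- The supremum of `T` is the cosine of the limiting distance from `a` to the sets; any level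
  -- above it is missed by some `C N`.
  set T : Set ℝ := {s | ∀ n, ∃ q ∈ C n, s ≤ Real.cos (k * dist q a)} with hT
  have hbdd : BddAbove T := ⟨1, fun s hs => by
    obtain ⟨q, -, hq⟩ := hs 0
    exact hq.trans (Real.cos_le_one _)⟩
  set S := sSup T with hS
  have hSr : r ≤ S := le_csSup hbdd hmeet
  have hS0 : 0 < S := hr.trans_le hSr
  have hpos : ∀ n : ℕ, (0 : ℝ) < 1 / ((n : ℝ) + 1) := fun n => Nat.one_div_pos_of_nat
  have hup : ∀ n : ℕ, ∃ N, ∀ q ∈ C N, Real.cos (k * dist q a) < S + 1 / ((n : ℝ) + 1) := by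
    intro n
    by_contra! hcon
    have : S + 1 / ((n : ℝ) + 1) ≤ S := le_csSup hbdd hcon
    linarith [hpos n]
  choose N hN using hup
  -- A monotone index dominating both n and `N n`, so that midpoints of later terms lie in `C (N n)`
  -- and obey its upper bound.
  set M : ℕ → ℕ := fun n => n + ∑ i ∈ Finset.range (n + 1), N i with hM
  have hMmono : Monotone M := by
    intro n m hnm
    exact add_le_add hnm (Finset.sum_le_sum_of_subset
      (Finset.range_subset_range.2 (by omega)))
  have hMN : ∀ n, N n ≤ M n := fun n =>
    (Finset.single_le_sum (f := N) (fun _ _ => Nat.zero_le _)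
      (Finset.self_mem_range_succ n)).trans (Nat.le_add_left _ _)
  have hlow : ∀ n : ℕ, ∃ q ∈ C (M n), S - 1 / ((n : ℝ) + 1) ≤ Real.cos (k * dist q a) := by
    intro n
    obtain ⟨s, hs, hlt⟩ := exists_lt_of_lt_csSup (s := T) ⟨r, hmeet⟩
      (show S - 1 / ((n : ℝ) + 1) < sSup T by linarith [hpos n])
    obtain ⟨q, hq, hqs⟩ := hs (M n)
    exact ⟨q, hq, hlt.le.trans hqs⟩
  choose u huC hu using hlow
  have htend : Tendsto (fun n : ℕ => (1 : ℝ) / ((n : ℝ) + 1)) atTop (𝓝 0) :=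
    tendsto_one_div_add_atTop_nhds_zero_nat
  have hcauchy : CauchySeq u := by
    refine H.cauchySeq (b := fun n => 2 / S * (1 / ((n : ℝ) + 1))) ?_ ?_
    · simpa using htend.const_mul (2 / S)
    · intro n m hnm
      obtain ⟨z, hz⟩ := H.exists_comb (1 / 2) (u n) (u m)
      have hzC : z ∈ C (N n) := hanti (hMN n)
        (hconv _ _ (huC n) _ (hanti (hMmono hnm) (huC m)) z hz)
      have h1 := H.midpoint hz a
      have h2 := hN n z hzC
      have h3 := hu n
      have h4 := hu m
      have h5 : (1 : ℝ) / ((m : ℝ) + 1) ≤ 1 / ((n : ℝ) + 1) :=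
        Nat.one_div_le_one_div hnm
      have h6 := H.cos_half_nonneg (u n) (u m)
      have h7 := Real.cos_le_one (k * dist (u n) (u m) / 2)
      set c := Real.cos (k * dist (u n) (u m) / 2)
      set e := (1 : ℝ) / ((n : ℝ) + 1)
      -- Both end points have cosine at least S - e, their midpoint less than S + e.
      have h8 : S - e ≤ (S + e) * c := by nlinarith
      have he : 0 < e := hpos n
      have h9 : S - 2 * e ≤ S * c := by nlinarith
      have : S * (1 - 2 / S * e) ≤ S * c := by
        have e1 : S * (1 - 2 / S * e) = S - 2 * e := by field_simp
        linarith
      exact le_of_mul_le_mul_left this hS0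
  obtain ⟨p, hp⟩ := cauchySeq_tendsto_of_complete hcauchy
  refine ⟨p, fun n => ?_, fun s hs => ?_⟩
  · refine (hcl n).mem_of_tendsto hp ?_
    filter_upwards [eventually_ge_atTop n] with m hm
    exact hanti (hm.trans (Nat.le_add_right _ _)) (huC m)
  · have hsS : s ≤ S := le_csSup hbdd hs
    refine hsS.trans ?_
    have h1 : Tendsto (fun n : ℕ => S - 1 / ((n : ℝ) + 1)) atTop (𝓝 S) := by
      simpa using htend.const_sub S
    have h2 : Tendsto (fun n => Real.cos (k * dist (u n) a)) atTop
        (𝓝 (Real.cos (k * dist p a))) :=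
      (Real.continuous_cos.tendsto _).comp ((hp.dist tendsto_const_nhds).const_mul k)
    exact le_of_tendsto_of_tendsto' h1 h2 hu

/-- A closed-sublevel, midpoint-quasiconvex function with a minimizing sequence in a ball of
radius less than a quarter of a great circle attains its infimum in that ball. -/
theorem exists_le_of_minimizing [CompleteSpace X] (H : SphericalConvexity k X) {g : X → EReal}
    (hcl : ∀ c : ℝ, IsClosed {x | g x ≤ c})
    (hconv : ∀ (c : ℝ) (x y z : X), g x ≤ c → g y ≤ c → IsGeodesicCombination (1 / 2) x y z →
      g z ≤ c)
    {m : ℝ} (a : X) {r : ℝ} (hr : 0 < r)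
    (hmin : ∀ ε : ℝ, 0 < ε → ∃ w, g w ≤ ((m + ε : ℝ) : EReal) ∧ r ≤ Real.cos (k * dist w a)) :
    ∃ p, g p ≤ m ∧ r ≤ Real.cos (k * dist p a) := by
  obtain ⟨p, hp, hpa⟩ := H.exists_mem_iInter
    (C := fun n : ℕ => {x | g x ≤ ((m + 1 / ((n : ℝ) + 1) : ℝ) : EReal)})
    (fun n j hnj x hx => le_trans (show g x ≤ _ from hx) (by
      have := Nat.one_div_le_one_div (α := ℝ) hnj
      exact_mod_cast (by linarith : m + 1 / ((j : ℝ) + 1) ≤ m + 1 / ((n : ℝ) + 1))))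
    (fun n => hcl _) (fun n x hx y hy z hz => hconv _ x y z hx hy hz) a hr
    (fun n => hmin _ Nat.one_div_pos_of_nat)
  refine ⟨p, ?_, hpa r fun n => hmin _ Nat.one_div_pos_of_nat⟩
  have h1 : Tendsto (fun n : ℕ => ((m + 1 / ((n : ℝ) + 1) : ℝ) : EReal)) atTop (𝓝 (m : EReal)) := by
    refine (continuous_coe_real_ereal.tendsto m).comp ?_
    simpa using (tendsto_one_div_add_atTop_nhds_zero_nat (𝕜 := ℝ)).const_add m
  exact ge_of_tendsto' h1 hp

end SphericalConvexity

/-! ### Convex functions with extended real values. -/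

theorem exists_real_infimum {Y : Type*} {g : Y → EReal} {B : ℝ} (hB : ∀ x, (B : EReal) ≤ g x)
    (hg : ∃ x, g x ≠ ⊤) :
    ∃ m : ℝ, (∀ x, (m : EReal) ≤ g x) ∧ ∀ ε : ℝ, 0 < ε → ∃ w, g w ≤ ((m + ε : ℝ) : EReal) := by
  obtain ⟨x, hx⟩ := hg
  have h1 : (⨅ x, g x) ≠ ⊤ := fun h => hx (top_le_iff.1 (h ▸ iInf_le g x))
  have h2 : (⨅ x, g x) ≠ ⊥ := fun h => by
    have := le_iInf hB
    rw [h] at this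
    exact EReal.coe_ne_bot B (le_bot_iff.1 this)
  refine ⟨(⨅ x, g x).toReal, ?_, fun ε hε => ?_⟩
  · rw [EReal.coe_toReal h1 h2]
    exact fun x => iInf_le g x
  · have : (⨅ x, g x) < (((⨅ x, g x).toReal + ε : ℝ) : EReal) := by
      conv_lhs => rw [← EReal.coe_toReal h1 h2]
      exact_mod_cast (by linarith)
    obtain ⟨w, hw⟩ := iInf_lt_iff.1 this
    exact ⟨w, hw.le⟩

theorem IsGeodesicallyConvex.le_coe {f : X → EReal} (hf : IsGeodesicallyConvex f) {x y z : X}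
    {a : ℝ} (ha : a ∈ Set.Ioo (0 : ℝ) 1) (hz : IsGeodesicCombination a x y z) {s t : ℝ}
    (hs : f x ≤ s) (ht : f y ≤ t) : f z ≤ ((a * s + (1 - a) * t : ℝ) : EReal) := by
  refine (hf x y z a ha hz).trans ?_
  rw [EReal.coe_add, EReal.coe_mul, EReal.coe_mul]
  refine add_le_add (mul_le_mul_of_nonneg_left hs ?_) (mul_le_mul_of_nonneg_left ht ?_)
  · exact_mod_cast ha.1.le
  · exact_mod_cast (by linarith [ha.2] : 0 ≤ 1 - a)

theorem IsGeodesicallyConvex.midpoint_le {f : X → EReal} (hf : IsGeodesicallyConvex f)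
    (c : ℝ) (x y z : X) (hx : f x ≤ c) (hy : f y ≤ c) (hz : IsGeodesicCombination (1 / 2) x y z) :
    f z ≤ c := by
  have := hf.le_coe ⟨by norm_num, by norm_num⟩ hz hx hy
  rwa [show (1 / 2 * c + (1 - 1 / 2) * c : ℝ) = c by ring] at this

/-- A proper, lower semicontinuous, convex function is bounded below. -/
theorem SphericalConvexity.exists_lower_bound [CompleteSpace X] {k : ℝ}
    (H : SphericalConvexity k X) {f : X → EReal} (hf_proper : IsProper f)
    (hf_lsc : LowerSemicontinuous f) (hf_convex : IsGeodesicallyConvex f) :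
    ∃ B : ℝ, ∀ x, (B : EReal) ≤ f x := by
  by_contra! hcon
  obtain ⟨hbot, a, ha⟩ := hf_proper
  obtain ⟨s, hs⟩ : ∃ s : ℝ, f a = s := ⟨_, (EReal.coe_toReal ha (hbot a)).symm⟩
  obtain ⟨p, hp, -⟩ := H.exists_mem_iInter
    (C := fun n : ℕ => {x | f x ≤ ((-(n : ℝ) : ℝ) : EReal)})
    (fun n j hnj x hx => le_trans (show f x ≤ _ from hx) (by
      have : (n : ℝ) ≤ j := by exact_mod_cast hnj
      exact_mod_cast (by linarith : -(j : ℝ) ≤ -(n : ℝ))))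
    (fun n => hf_lsc.isClosed_preimage _)
    (fun n x hx y hy z hz => hf_convex.midpoint_le _ x y z hx hy hz) a
    (r := Real.cos (Real.pi / 4))
    (Real.cos_pos_of_mem_Ioo ⟨by linarith [Real.pi_pos], by linarith [Real.pi_pos]⟩)
    (fun n => by
      -- The value is chosen so that the midpoint with `a` has value at most -n; that midpoint lies
      -- within D_κ/4 of `a`, however far `w` is.
      obtain ⟨w, hw⟩ := hcon (-(2 * n) - s)
      obtain ⟨z, hz⟩ := H.exists_comb (1 / 2) a w
      refine ⟨z, ?_, ?_⟩
      · have := hf_convex.le_coe ⟨by norm_num, by norm_num⟩ hz hs.le hw.le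
        rwa [show (1 / 2 * s + (1 - 1 / 2) * (-(2 * n) - s) : ℝ) = -n by ring] at this
      · rw [dist_comm, hz.dist_left ⟨by norm_num, by norm_num⟩]
        have h1 := H.lt a w
        have h2 := H.nonneg a w
        refine Real.cos_le_cos_of_nonneg_of_le_pi ?_ ?_ ?_ <;> linarith [Real.pi_pos])
  obtain ⟨t, ht⟩ : ∃ t : ℝ, (t : EReal) ≤ f p := by
    rcases eq_or_ne (f p) ⊤ with h | h
    · exact ⟨0, h ▸ le_top⟩
    · exact ⟨_, (EReal.coe_toReal h (hbot p)).le⟩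
  obtain ⟨n, hn⟩ := exists_nat_gt (-t)
  have := ht.trans (hp n)
  have : t ≤ -(n : ℝ) := by exact_mod_cast this
  linarith

/-! ### The resolvent: existence, uniqueness and two estimates. -/

theorem tan_mul_sin_eq {u : ℝ} (hu : Real.cos u ≠ 0) :
    Real.tan u * Real.sin u = 1 / Real.cos u - Real.cos u := by
  rw [Real.tan_eq_sin_div_cos]
  field_simp
  linarith [Real.sin_sq_add_cos_sq u]

/-- The function t ↦ 1/t - t is decreasing and convex. With A the mean of a and b, A ≤ zc gives 1/z
≤ c/A, and 1/A - c/A ≥ 1 - c since A ≤ 1; this is the gain. -/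
theorem one_div_sub_self_midpoint {a b z c : ℝ} (ha : 0 < a) (hb : 0 < b) (ha1 : a ≤ 1)
    (hb1 : b ≤ 1) (hc : 0 ≤ c) (hc1 : c ≤ 1) (h : a + b ≤ 2 * (z * c)) :
    1 / z - z + (1 - c) ≤ ((1 / a - a) + (1 / b - b)) / 2 := by
  have hzc : 0 < z * c := by linarith
  have hz : 0 < z := by
    by_contra hn
    nlinarith
  set A := (a + b) / 2 with hA
  have hA0 : 0 < A := by positivity
  have hA1 : A ≤ 1 := by linarith
  have hAzc : A ≤ z * c := by linarith
  have hAz : A ≤ z := hAzc.trans (mul_le_of_le_one_right hz.le hc1)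
  have h1 : 1 / z ≤ c / A := by
    rw [div_le_div_iff₀ hz hA0]; linarith
  have h2 : 1 / A ≤ (1 / a + 1 / b) / 2 := by
    rw [hA]
    field_simp
    nlinarith [sq_nonneg (a - b)]
  have h3 : c / A + (1 - c) ≤ 1 / A := by
    have : 1 / A - c / A - (1 - c) = (1 - c) * (1 - A) / A := by field_simp
    have : 0 ≤ (1 - c) * (1 - A) / A :=
      div_nonneg (mul_nonneg (by linarith) (by linarith)) hA0.le
    linarith
  linarith

theorem ereal_add_coe_le_iff {u : EReal} {b c : ℝ} :
    u + (b : EReal) ≤ c ↔ u ≤ ((c - b : ℝ) : EReal) := by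
  induction u with
  | bot => simp
  | top => simp only [EReal.top_add_coe, top_le_iff, EReal.coe_ne_top]
  | coe a =>
    rw [← EReal.coe_add, EReal.coe_le_coe_iff, EReal.coe_le_coe_iff, le_sub_iff_add_le]

variable {κ : ℝ}

/-- The penalty term of the resolvent, in terms of the cosine of the distance. -/
def penalty (κ η : ℝ) (x y : X) : ℝ :=
  1 / η * (1 / Real.cos (Real.sqrt κ * dist y x) - Real.cos (Real.sqrt κ * dist y x))

namespace SphericalConvexity

theorem penalty_nonneg (H : SphericalConvexity (Real.sqrt κ) X) {η : ℝ} (hη : 0 < η) (x y : X) :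
    0 ≤ penalty κ η x y := by
  refine mul_nonneg (by positivity) ?_
  have h1 := H.cos_pos y x
  have h2 := Real.cos_le_one (Real.sqrt κ * dist y x)
  have : 1 ≤ 1 / Real.cos (Real.sqrt κ * dist y x) := by rwa [le_div_iff₀ h1, one_mul]
  linarith

theorem continuous_penalty (H : SphericalConvexity (Real.sqrt κ) X) (η : ℝ) (x : X) :
    Continuous (penalty κ η x) := by
  have h : Continuous fun y => Real.cos (Real.sqrt κ * dist y x) :=
    Real.continuous_cos.comp (continuous_const.mul (continuous_id.dist continuous_const))
  exact continuous_const.mul ((continuous_const.div h fun y => (H.cos_pos y x).ne').sub h)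

theorem penalty_midpoint (H : SphericalConvexity (Real.sqrt κ) X) {η : ℝ} (hη : 0 < η) (x : X)
    {p q z : X} (hz : IsGeodesicCombination (1 / 2) p q z) :
    penalty κ η x z + 1 / η * (1 - Real.cos (Real.sqrt κ * dist p q / 2))
      ≤ (penalty κ η x p + penalty κ η x q) / 2 := by
  have := one_div_sub_self_midpoint (H.cos_pos p x) (H.cos_pos q x) (Real.cos_le_one _)
    (Real.cos_le_one _) (H.cos_half_nonneg p q) (Real.cos_le_one _) (H.midpoint hz x)
  have := mul_le_mul_of_nonneg_left this (one_div_pos.2 hη).le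
  unfold penalty
  linarith

theorem penalty_le_iff (H : SphericalConvexity (Real.sqrt κ) X) {η : ℝ} (hη : 0 < η) {x p q : X} :
    penalty κ η x p ≤ penalty κ η x q ↔
      Real.cos (Real.sqrt κ * dist q x) ≤ Real.cos (Real.sqrt κ * dist p x) := by
  have hp := H.cos_pos p x
  have hq := H.cos_pos q x
  unfold penalty
  rw [mul_le_mul_iff_right₀ (one_div_pos.2 hη)]
  constructor
  · intro h
    by_contra! hlt
    have := one_div_lt_one_div_of_lt hp hlt
    linarith
  · intro h
    have := one_div_le_one_div_of_le hq h
    linarith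

theorem resolventObjective_eq (H : SphericalConvexity (Real.sqrt κ) X) (f : X → EReal) (η : ℝ)
    (x y : X) : resolventObjective κ f η x y = f y + (penalty κ η x y : EReal) := by
  unfold resolventObjective penalty
  rw [tan_mul_sin_eq (H.cos_pos y x).ne']

theorem resolventObjective_le_iff (H : SphericalConvexity (Real.sqrt κ) X) {f : X → EReal}
    {η : ℝ} {x y : X} {c : ℝ} :
    resolventObjective κ f η x y ≤ c ↔ f y ≤ ((c - penalty κ η x y : ℝ) : EReal) := by
  rw [H.resolventObjective_eq, ereal_add_coe_le_iff]

theorem resolventObjective_midpoint (H : SphericalConvexity (Real.sqrt κ) X) {f : X → EReal}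
    (hf_convex : IsGeodesicallyConvex f) {η : ℝ} (hη : 0 < η) {x p q z : X} {c : ℝ}
    (hp : resolventObjective κ f η x p ≤ c) (hq : resolventObjective κ f η x q ≤ c)
    (hz : IsGeodesicCombination (1 / 2) p q z) :
    resolventObjective κ f η x z
      ≤ ((c - 1 / η * (1 - Real.cos (Real.sqrt κ * dist p q / 2)) : ℝ) : EReal) := by
  rw [H.resolventObjective_le_iff] at hp hq ⊢
  refine (hf_convex.le_coe ⟨by norm_num, by norm_num⟩ hz hp hq).trans ?_
  have := H.penalty_midpoint hη x hz
  exact_mod_cast (by linarith)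

variable [CompleteSpace X]

theorem exists_argmin_resolventObjective (H : SphericalConvexity (Real.sqrt κ) X)
    {f : X → EReal} (hf_proper : IsProper f) (hf_lsc : LowerSemicontinuous f)
    (hf_convex : IsGeodesicallyConvex f) {η : ℝ} (hη : 0 < η) (x : X) :
    ∃ p, argmin (resolventObjective κ f η x) = {p} := by
  obtain ⟨B, hB⟩ := H.exists_lower_bound hf_proper hf_lsc hf_convex
  obtain ⟨-, a, ha⟩ := hf_proper
  have hB' : ∀ y, (B : EReal) ≤ resolventObjective κ f η x y := fun y => by
    rw [H.resolventObjective_eq]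
    refine (hB y).trans (le_add_of_nonneg_right ?_)
    exact_mod_cast H.penalty_nonneg hη x y
  have htop : ∃ y, resolventObjective κ f η x y ≠ ⊤ :=
    ⟨a, by rw [H.resolventObjective_eq]; exact EReal.add_ne_top ha (EReal.coe_ne_top _)⟩
  obtain ⟨m, hm, hmin⟩ := exists_real_infimum hB' htop
  have hmB : ∀ ε : ℝ, 0 < ε → 0 ≤ m + ε - B := fun ε hε => by
    obtain ⟨w, hw⟩ := hmin ε hε
    have : B ≤ m + ε := by exact_mod_cast (hB' w).trans hw
    linarith
  have hR : 0 ≤ η * (m + 1 - B) := mul_nonneg hη.le (hmB 1 one_pos)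
  obtain ⟨p, hp, -⟩ := H.exists_le_of_minimizing (g := resolventObjective κ f η x) (m := m)
    (fun c => by
      -- Moving the continuous real penalty to the right exhibits the sublevel set as a preimage of
      -- the closed epigraph of `f`.
      have : {y | resolventObjective κ f η x y ≤ c}
          = (fun y => (y, ((c - penalty κ η x y : ℝ) : EReal))) ⁻¹' {q | f q.1 ≤ q.2} := by
        ext y; exact H.resolventObjective_le_iff
      rw [this]
      exact hf_lsc.isClosed_epigraph.preimage (continuous_id.prodMk
        (continuous_coe_real_ereal.comp (continuous_const.sub (H.continuous_penalty η x)))))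
    (fun c y w z hy hw hz => (H.resolventObjective_midpoint hf_convex hη hy hw hz).trans (by
      have : 0 ≤ 1 / η * (1 - Real.cos (Real.sqrt κ * dist y w / 2)) :=
        mul_nonneg (by positivity) (by linarith [Real.cos_le_one (Real.sqrt κ * dist y w / 2)])
      exact_mod_cast (by linarith)))
    -- Near-minimizers have penalty at most m + 1 - B, so 1/cos ≤ η(m + 1 - B) + cos, and the last
    -- cosine is at most 1.
    x (r := 1 / (η * (m + 1 - B) + 1)) (by positivity)
    (fun ε hε => by
      obtain ⟨w, hw⟩ := hmin (min ε 1) (lt_min hε one_pos)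
      refine ⟨w, hw.trans ?_, ?_⟩
      · exact_mod_cast (by linarith [min_le_left ε 1])
      · rw [H.resolventObjective_le_iff] at hw
        have h1 : B ≤ m + min ε 1 - penalty κ η x w := by exact_mod_cast (hB w).trans hw
        have h2 : penalty κ η x w ≤ m + 1 - B := by linarith [min_le_right ε 1]
        have hc := H.cos_pos w x
        have h3 := mul_le_mul_of_nonneg_left h2 hη.le
        unfold penalty at h3
        rw [← mul_assoc, mul_one_div_cancel hη.ne', one_mul] at h3
        rw [div_le_iff₀ (by positivity), mul_comm, ← div_le_iff₀ hc]
        linarith [Real.cos_le_one (Real.sqrt κ * dist w x)])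
  have hp' : p ∈ argmin (resolventObjective κ f η x) := fun y => hp.trans (hm y)
  refine ⟨p, Set.eq_singleton_iff_unique_mem.2 ⟨hp', fun q hq => ?_⟩⟩
  -- Two distinct minimizers would have a midpoint of value strictly below m.
  obtain ⟨z, hz⟩ := H.exists_comb (1 / 2) q p
  have h1 := (hm z).trans (H.resolventObjective_midpoint hf_convex hη ((hq p).trans hp) hp hz)
  have h2 : m ≤ m - 1 / η * (1 - Real.cos (Real.sqrt κ * dist q p / 2)) := by exact_mod_cast h1
  refine H.eq_of_one_le_cos_half ?_
  by_contra! hlt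
  have : 0 < 1 / η * (1 - Real.cos (Real.sqrt κ * dist q p / 2)) :=
    mul_pos (one_div_pos.2 hη) (by linarith)
  linarith

theorem argmin_resolventObjective (H : SphericalConvexity (Real.sqrt κ) X)
    {f : X → EReal} (hf_proper : IsProper f) (hf_lsc : LowerSemicontinuous f)
    (hf_convex : IsGeodesicallyConvex f) {η : ℝ} (hη : 0 < η) (x : X) :
    argmin (resolventObjective κ f η x) = {resolvent κ f η x} := by
  obtain ⟨p, hp⟩ := H.exists_argmin_resolventObjective hf_proper hf_lsc hf_convex hη x
  have hmem : resolvent κ f η x ∈ argmin (resolventObjective κ f η x) :=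
    @Classical.epsilon_spec_aux X ⟨x⟩ (fun z => z ∈ argmin (resolventObjective κ f η x))
      ⟨p, hp ▸ rfl⟩
  rw [hp] at hmem ⊢
  rw [hmem]

theorem exists_resolvent_value (H : SphericalConvexity (Real.sqrt κ) X)
    {f : X → EReal} (hf_proper : IsProper f) (hf_lsc : LowerSemicontinuous f)
    (hf_convex : IsGeodesicallyConvex f) {η : ℝ} (hη : 0 < η) (x : X) :
    ∃ s : ℝ, f (resolvent κ f η x) = s ∧ ∀ (w : X) (t : ℝ), f w ≤ t →
      s + penalty κ η x (resolvent κ f η x) ≤ t + penalty κ η x w := by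
  have hmem : resolvent κ f η x ∈ argmin (resolventObjective κ f η x) := by
    rw [H.argmin_resolventObjective hf_proper hf_lsc hf_convex hη x]; rfl
  obtain ⟨hbot, a, ha⟩ := hf_proper
  have key : ∀ (w : X) (t : ℝ), f w ≤ t → f (resolvent κ f η x) ≤
      ((t + penalty κ η x w - penalty κ η x (resolvent κ f η x) : ℝ) : EReal) := by
    intro w t hw
    rw [← H.resolventObjective_le_iff]
    refine (hmem w).trans ?_
    rw [H.resolventObjective_le_iff]
    simpa using hw
  have htop : f (resolvent κ f η x) ≠ ⊤ := by
    intro h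
    have := key a _ (EReal.coe_toReal ha (hbot a)).ge
    rw [h] at this
    exact EReal.coe_ne_top _ (top_le_iff.1 this)
  refine ⟨_, (EReal.coe_toReal htop (hbot _)).symm, fun w t hw => ?_⟩
  have := key w t hw
  rw [← EReal.coe_toReal htop (hbot _)] at this
  have : (f (resolvent κ f η x)).toReal
      ≤ t + penalty κ η x w - penalty κ η x (resolvent κ f η x) := by exact_mod_cast this
  linarith

/-- The resolvent is strongly quasi-nonexpansive in the spherical sense. -/
theorem cos_le_cos_mul_cos_resolvent (H : SphericalConvexity (Real.sqrt κ) X)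
    {f : X → EReal} (hf_proper : IsProper f) (hf_lsc : LowerSemicontinuous f)
    (hf_convex : IsGeodesicallyConvex f) {η : ℝ} (hη : 0 < η) (x : X) {p : X}
    (hp : p ∈ argmin f) :
    Real.cos (Real.sqrt κ * dist p x)
      ≤ Real.cos (Real.sqrt κ * dist p (resolvent κ f η x))
        * Real.cos (Real.sqrt κ * dist (resolvent κ f η x) x) := by
  obtain ⟨s, hs, hmin⟩ := H.exists_resolvent_value hf_proper hf_lsc hf_convex hη x
  set z := resolvent κ f η x
  rcases (dist_nonneg (x := p) (y := z)).eq_or_lt with h0 | hpos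
  · rw [dist_eq_zero.1 h0.symm]; simp
  have hps : f p ≤ s := hs ▸ hp z
  have hA : 0 < Real.sqrt κ * dist p z := mul_pos H.pos hpos
  have hAlt := H.lt p z
  -- Points of [p, z] have value at most f z, so by minimality none is closer to x than z. Inserting
  -- this in `le_cos` and cancelling 2 sin(aA/2) gives the bound; a → 0 moves the test point to z.
  have hle : ∀ a ∈ Set.Ioo (0 : ℝ) 1,
      Real.cos (Real.sqrt κ * dist p x) * Real.cos (a * (Real.sqrt κ * dist p z) / 2)
        ≤ Real.cos ((1 - a / 2) * (Real.sqrt κ * dist p z))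
          * Real.cos (Real.sqrt κ * dist z x) := by
    intro a ha
    obtain ⟨w, hw⟩ := H.exists_comb a p z
    have hws := hf_convex.le_coe ha hw hps hs.le
    rw [show a * s + (1 - a) * s = s by ring] at hws
    have hcos := (H.penalty_le_iff hη).1 (le_of_add_le_add_left (hmin w s hws))
    have hkey := H.le_cos a p z w x ⟨ha.1.le, ha.2.le⟩ hw
    set A := Real.sqrt κ * dist p z
    have hsA : 0 < Real.sin A := Real.sin_pos_of_pos_of_lt_pi hA (by linarith)
    have hsa : 0 < Real.sin (a * A / 2) := Real.sin_pos_of_pos_of_lt_pi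
      (by have := mul_pos ha.1 hA; linarith) (by nlinarith [ha.2])
    have e1 : Real.sin (a * A) = 2 * Real.sin (a * A / 2) * Real.cos (a * A / 2) := by
      rw [← Real.sin_two_mul]; congr 1; ring
    have e2 : Real.sin A - Real.sin ((1 - a) * A)
        = 2 * Real.sin (a * A / 2) * Real.cos ((1 - a / 2) * A) := by
      rw [Real.sin_sub_sin]; congr 3 <;> ring
    have h1 := mul_le_mul_of_nonneg_right hcos hsA.le
    refine le_of_mul_le_mul_left ?_ (mul_pos two_pos hsa)
    rw [e1] at hkey
    have e3 : (Real.sin A - Real.sin ((1 - a) * A)) * Real.cos (Real.sqrt κ * dist z x)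
        = 2 * Real.sin (a * A / 2) * Real.cos ((1 - a / 2) * A)
          * Real.cos (Real.sqrt κ * dist z x) := by rw [e2]
    linarith
  have t1 : Tendsto (fun a : ℝ => Real.cos (Real.sqrt κ * dist p x)
      * Real.cos (a * (Real.sqrt κ * dist p z) / 2)) (𝓝[>] 0)
      (𝓝 (Real.cos (Real.sqrt κ * dist p x))) := by
    have : Continuous (fun a : ℝ => Real.cos (Real.sqrt κ * dist p x)
      * Real.cos (a * (Real.sqrt κ * dist p z) / 2)) := by fun_prop
    simpa using (this.tendsto 0).mono_left nhdsWithin_le_nhds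
  have t2 : Tendsto (fun a : ℝ => Real.cos ((1 - a / 2) * (Real.sqrt κ * dist p z))
          * Real.cos (Real.sqrt κ * dist z x)) (𝓝[>] 0)
      (𝓝 (Real.cos (Real.sqrt κ * dist p z) * Real.cos (Real.sqrt κ * dist z x))) := by
    have : Continuous (fun a : ℝ => Real.cos ((1 - a / 2) * (Real.sqrt κ * dist p z))
          * Real.cos (Real.sqrt κ * dist z x)) := by fun_prop
    simpa using (this.tendsto 0).mono_left nhdsWithin_le_nhds
  refine le_of_tendsto_of_tendsto t1 t2 ?_
  filter_upwards [Ioo_mem_nhdsGT (zero_lt_one' ℝ)] with a ha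
  exact hle a ha

/-- The value at the resolvent exceeds any other value by at most a constant over `η`, as long
as the resolvent stays close to the point. -/
theorem resolvent_value_le (H : SphericalConvexity (Real.sqrt κ) X)
    {f : X → EReal} (hf_proper : IsProper f) (hf_lsc : LowerSemicontinuous f)
    (hf_convex : IsGeodesicallyConvex f) {η : ℝ} (hη : 0 < η) (x : X) {c : ℝ} (hc : 0 < c)
    (hcx : c ≤ Real.cos (Real.sqrt κ * dist (resolvent κ f η x) x)) {w : X} {t : ℝ}
    (hw : f w ≤ t) :
    f (resolvent κ f η x) ≤ ((t + 4 / c * (1 / η) : ℝ) : EReal) := by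
  obtain ⟨s, hs, hmin⟩ := H.exists_resolvent_value hf_proper hf_lsc hf_convex hη x
  set z := resolvent κ f η x
  -- Testing at `w` itself would involve cos k d(w,x), which has no uniform lower bound; the
  -- midpoint has cosine at least c/2 whatever `w` is.
  obtain ⟨m, hm⟩ := H.exists_comb (1 / 2) w z
  have h1 := hmin m _ (hf_convex.le_coe ⟨by norm_num, by norm_num⟩ hm hw hs.le)
  have h2 := H.penalty_nonneg hη x z
  have hcm : c / 2 ≤ Real.cos (Real.sqrt κ * dist m x) := by
    have h3 := H.midpoint hm x
    have h4 := H.cos_pos w x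
    have h5 := mul_le_of_le_one_right (H.cos_pos m x).le
      (Real.cos_le_one (Real.sqrt κ * dist w z / 2))
    linarith
  have h3 : penalty κ η x m ≤ 1 / η * (2 / c) := by
    unfold penalty
    refine mul_le_mul_of_nonneg_left ?_ (by positivity)
    have h4 := one_div_le_one_div_of_le (by positivity) hcm
    rw [one_div_div] at h4
    linarith [H.cos_pos m x]
  rw [hs]
  have e : 4 / c * (1 / η) = 2 * (1 / η * (2 / c)) := by ring
  exact_mod_cast (by rw [e]; linarith : s ≤ t + 4 / c * (1 / η))

end SphericalConvexity

/-! ### Real inequalities behind the Halpern step. -/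

theorem mul_sin_le_sin_mul {a u : ℝ} (ha : a ∈ Set.Icc (0 : ℝ) 1) (hu : 0 ≤ u)
    (huπ : u ≤ Real.pi) : a * Real.sin u ≤ Real.sin (a * u) := by
  have h0 : (0 : ℝ) ∈ Set.Icc 0 Real.pi := ⟨le_rfl, Real.pi_pos.le⟩
  have hu' : u ∈ Set.Icc 0 Real.pi := ⟨hu, huπ⟩
  have := strictConcaveOn_sin_Icc.concaveOn.2 h0 hu' (sub_nonneg.2 ha.2) ha.1 (by ring)
  simpa using this

/-- One step of the Halpern iteration on the sphere: the defect `1 - ε - cos` contracts by the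
factor `1 - a ^ 2 / 2`. -/
theorem spherical_halpern_step {a A C ε c c' : ℝ} (ha : a ∈ Set.Icc (0 : ℝ) 1) (hA : 0 < A)
    (hAπ : A ≤ Real.pi / 2)
    (hstep : C * Real.sin (a * A) + c * Real.sin ((1 - a) * A) ≤ c' * Real.sin A)
    (h : (1 - ε) * Real.cos ((1 - a / 2) * A) ≤ C * Real.cos (a * A / 2)) :
    max 0 (1 - ε - c') ≤ (1 - a ^ 2 / 2) * max 0 (1 - ε - c) := by
  have hπ := Real.pi_pos
  have hsA : 0 < Real.sin A := Real.sin_pos_of_pos_of_lt_pi hA (by linarith)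
  have haA : 0 ≤ a * A := mul_nonneg ha.1 hA.le
  have haA' : a * A ≤ A := mul_le_of_le_one_left hA.le ha.2
  have hs : 0 ≤ Real.sin (a * A / 2) :=
    Real.sin_nonneg_of_nonneg_of_le_pi (by linarith) (by linarith)
  have hs' : 0 ≤ Real.sin ((1 - a) * A) :=
    Real.sin_nonneg_of_nonneg_of_le_pi (by linarith) (by linarith)
  have e1 : Real.sin (a * A) = 2 * Real.sin (a * A / 2) * Real.cos (a * A / 2) := by
    rw [← Real.sin_two_mul]; congr 1; ring
  have e2 : Real.sin A - Real.sin ((1 - a) * A)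
      = 2 * Real.sin (a * A / 2) * Real.cos ((1 - a / 2) * A) := by
    rw [Real.sin_sub_sin]; congr 3 <;> ring
  have e3 : Real.sin A = 2 * Real.sin (A / 2) * Real.cos (A / 2) := by
    rw [← Real.sin_two_mul]; congr 1; ring
  have h1 : Real.sin A * (1 - ε - c') ≤ Real.sin ((1 - a) * A) * (1 - ε - c) := by
    have h2 := mul_le_mul_of_nonneg_left h (mul_nonneg zero_le_two hs)
    have h3 : (1 - ε) * (Real.sin A - Real.sin ((1 - a) * A)) ≤ C * Real.sin (a * A) := by
      rw [e1, e2]; linarith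
    linarith
  -- The difference of sines is 2 sin(aA/2) cos((1 - a/2)A). As A may approach π/2, the cosine is
  -- only bounded below by a/2, whence a gain quadratic in a and the condition on ∑ α_n².
  have h2 : Real.sin ((1 - a) * A) ≤ (1 - a ^ 2 / 2) * Real.sin A := by
    have h3 : a * Real.sin (A / 2) ≤ Real.sin (a * A / 2) := by
      rw [mul_div_assoc]
      exact mul_sin_le_sin_mul ha (by linarith) (by linarith)
    have h4 : a / 2 ≤ Real.cos ((1 - a / 2) * A) := by
      have h5 : Real.cos ((1 - a / 2) * (Real.pi / 2)) ≤ Real.cos ((1 - a / 2) * A) := by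
        refine Real.cos_le_cos_of_nonneg_of_le_pi (mul_nonneg (by linarith [ha.2]) hA.le) ?_
          (mul_le_mul_of_nonneg_left hAπ (by linarith [ha.2]))
        nlinarith [ha.1]
      have h6 : Real.cos ((1 - a / 2) * (Real.pi / 2)) = Real.sin (a * (Real.pi / 4)) := by
        rw [← Real.cos_pi_div_two_sub]; congr 1; ring
      have h7 := Real.mul_le_sin (x := a * (Real.pi / 4)) (mul_nonneg ha.1 (by linarith))
        (by nlinarith [ha.2])
      have h8 : 2 / Real.pi * (a * (Real.pi / 4)) = a / 2 := by field_simp; ring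
      linarith
    have hsA2 : 0 ≤ Real.sin (A / 2) :=
      Real.sin_nonneg_of_nonneg_of_le_pi (by linarith) (by linarith)
    have h5 : a * Real.sin (A / 2) * (a / 2)
        ≤ Real.sin (a * A / 2) * Real.cos ((1 - a / 2) * A) :=
      mul_le_mul h3 h4 (by linarith [ha.1]) hs
    have h6 : a ^ 2 / 2 * Real.sin A ≤ a ^ 2 * Real.sin (A / 2) := by
      rw [e3]
      have := mul_le_mul_of_nonneg_left (Real.cos_le_one (A / 2))
        (mul_nonneg (sq_nonneg a) hsA2)
      linarith
    linarith
  have hmax0 : 0 ≤ max 0 (1 - ε - c) := le_max_left _ _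
  have ha2 : 0 ≤ 1 - a ^ 2 / 2 := by nlinarith [ha.1, ha.2]
  refine max_le (mul_nonneg ha2 hmax0) (le_of_mul_le_mul_left ?_ hsA)
  calc Real.sin A * (1 - ε - c') ≤ Real.sin ((1 - a) * A) * (1 - ε - c) := h1
    _ ≤ Real.sin ((1 - a) * A) * max 0 (1 - ε - c) :=
        mul_le_mul_of_nonneg_left (le_max_right _ _) hs'
    _ ≤ (1 - a ^ 2 / 2) * Real.sin A * max 0 (1 - ε - c) :=
        mul_le_mul_of_nonneg_right h2 hmax0
    _ = _ := by ring

/-- Supplies the last hypothesis of `spherical_halpern_step`. For small a it reduces to (1 - ε)(1 +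
ε/2) ≤ 1 - ε/4. -/
theorem cos_mul_le_of_cos_le {a A C ε : ℝ} (ha : 0 ≤ a) (hA : 0 ≤ A) (hAπ : A ≤ Real.pi / 2)
    (hC : 0 < C) (hC1 : C ≤ 1) (hε : 0 < ε) (hε1 : ε < 1) (haε : a ≤ ε * C / 4)
    (hcos : Real.cos A ≤ C + ε * C / 4) :
    (1 - ε) * Real.cos ((1 - a / 2) * A) ≤ C * Real.cos (a * A / 2) := by
  have hA2 : A ≤ 2 := by linarith [Real.pi_le_four]
  have hεC : ε * C ≤ ε := mul_le_of_le_one_right hε.le hC1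
  set u := a * A / 2 with hu
  have hu0 : 0 ≤ u := by positivity
  have hua : u ≤ a := by nlinarith
  have h1 : Real.cos ((1 - a / 2) * A) ≤ C + ε * C / 2 := by
    have e : (1 - a / 2) * A = A - u := by rw [hu]; ring
    rw [e, Real.cos_sub]
    have h2 : 0 ≤ Real.cos A :=
      Real.cos_nonneg_of_mem_Icc ⟨by linarith [Real.pi_pos], hAπ⟩
    have h3 : Real.cos A * Real.cos u ≤ Real.cos A :=
      mul_le_of_le_one_right h2 (Real.cos_le_one _)
    have h4 : Real.sin u ≤ u := Real.sin_le hu0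
    have h5 : 0 ≤ Real.sin u :=
      Real.sin_nonneg_of_nonneg_of_le_pi hu0 (by linarith [Real.pi_gt_three])
    have h6 : Real.sin A * Real.sin u ≤ Real.sin u :=
      mul_le_of_le_one_left h5 (Real.sin_le_one _)
    linarith
  have h2 : 1 - ε / 4 ≤ Real.cos u := by
    have := Real.one_sub_sq_div_two_le_cos (x := u)
    nlinarith
  have h3 := mul_le_mul_of_nonneg_left h1 (by linarith : 0 ≤ 1 - ε)
  have h4 := mul_le_mul_of_nonneg_left h2 hC.le
  nlinarith [mul_pos hε hC, mul_pos (mul_pos hε hε) hC]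

/-- Since 1 - b ≤ exp(-b) and u ≥ 0, u is eventually at most a constant times the exponential of
minus the partial sums. -/
theorem tendsto_zero_of_le_one_sub_mul {u b : ℕ → ℝ} (hu : ∀ n, 0 ≤ u n)
    (h : ∀ᶠ n in atTop, u (n + 1) ≤ (1 - b n) * u n)
    (hb : Tendsto (fun N => ∑ n ∈ Finset.range N, b n) atTop atTop) :
    Tendsto u atTop (𝓝 0) := by
  obtain ⟨N, hN⟩ := eventually_atTop.1 h
  set S : ℕ → ℝ := fun n => ∑ i ∈ Finset.range n, b i with hS
  have hle : ∀ n, N ≤ n → u n ≤ u N * Real.exp (S N - S n) := by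
    intro n hn
    induction n, hn using Nat.le_induction with
    | base => simp
    | succ n hn ih =>
      have h1 : 1 - b n ≤ Real.exp (-b n) := by linarith [Real.add_one_le_exp (-b n)]
      calc u (n + 1) ≤ (1 - b n) * u n := hN n hn
        _ ≤ Real.exp (-b n) * u n := mul_le_mul_of_nonneg_right h1 (hu n)
        _ ≤ Real.exp (-b n) * (u N * Real.exp (S N - S n)) :=
            mul_le_mul_of_nonneg_left ih (Real.exp_pos _).le
        _ = u N * Real.exp (S N - S (n + 1)) := by
            rw [mul_left_comm, ← Real.exp_add]
            congr 2
            simp only [hS, Finset.sum_range_succ]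
            ring
  refine squeeze_zero' (Eventually.of_forall hu)
    ((eventually_ge_atTop N).mono hle) ?_
  have h1 : Tendsto (fun n => S N - S n) atTop atBot :=
    tendsto_const_nhds.add_atBot (tendsto_neg_atTop_atBot.comp hb)
  simpa using (Real.tendsto_exp_atBot.comp h1).const_mul (u N)

theorem argmin_finite {Y : Type*} {f : Y → EReal} (hf_proper : IsProper f) {p : Y} (hp : p ∈ argmin f) :
    ∃ m : ℝ, f p = m := by
  obtain ⟨hbot, a, ha⟩ := hf_proper
  have : f p ≠ ⊤ := fun h => ha (top_le_iff.1 (h ▸ hp a))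
  exact ⟨_, (EReal.coe_toReal this (hbot p)).symm⟩

/-! ### Metric projection and convergence of the iteration. -/

namespace SphericalConvexity

/-- The metric projection onto a nonempty closed midpoint-convex set. -/
theorem exists_nearestPoints_eq_singleton [CompleteSpace X] {k : ℝ} (H : SphericalConvexity k X)
    {C : Set X} (hne : C.Nonempty) (hcl : IsClosed C)
    (hconv : ∀ x ∈ C, ∀ y ∈ C, ∀ z, IsGeodesicCombination (1 / 2) x y z → z ∈ C) (v : X) :
    ∃ p, nearestPoints C v = {p} := by
  obtain ⟨q₀, hq₀⟩ := hne
  obtain ⟨p, hp, hbest⟩ := H.exists_mem_iInter (C := fun _ => C) antitone_const (fun _ => hcl)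
    (fun _ => hconv) v (H.cos_pos q₀ v) (fun _ => ⟨q₀, hq₀, le_rfl⟩)
  have hpC : p ∈ C := hp 0
  have hpbest : ∀ q ∈ C, Real.cos (k * dist q v) ≤ Real.cos (k * dist p v) :=
    fun q hq => hbest _ fun _ => ⟨q, hq, le_rfl⟩
  refine ⟨p, Set.eq_singleton_iff_unique_mem.2 ⟨⟨hpC, fun q hq => ?_⟩, fun q hq => ?_⟩⟩
  · rw [dist_comm v p, dist_comm v q]
    exact H.cos_le_cos_iff.1 (hpbest q hq)
  · obtain ⟨z, hz⟩ := H.exists_comb (1 / 2) q p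
    have h1 := H.midpoint hz v
    have h2 := hpbest z (hconv q hq.1 p hpC z hz)
    have h3 : Real.cos (k * dist p v) ≤ Real.cos (k * dist q v) := by
      rw [H.cos_le_cos_iff, dist_comm q v, dist_comm p v]
      exact hq.2 p hpC
    have h4 := mul_le_mul_of_nonneg_right h2 (H.cos_half_nonneg q p)
    refine H.eq_of_one_le_cos_half (le_of_mul_le_mul_left ?_ (H.cos_pos p v))
    linarith

theorem tendsto_of_tendsto_cos {k : ℝ} (H : SphericalConvexity k X) {u : ℕ → X} {p : X}
    (h : Tendsto (fun n => Real.cos (k * dist (u n) p)) atTop (𝓝 1)) :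
    Tendsto u atTop (𝓝 p) := by
  rw [tendsto_iff_dist_tendsto_zero]
  have h1 : Tendsto (fun n => Real.sqrt (Real.pi ^ 2 / (2 * k ^ 2)
      * (1 - Real.cos (k * dist (u n) p)))) atTop (𝓝 0) := by
    have := (Real.continuous_sqrt.tendsto _).comp
      ((h.const_sub 1).const_mul (Real.pi ^ 2 / (2 * k ^ 2)))
    simpa [Function.comp_def] using this
  exact squeeze_zero (fun n => dist_nonneg)
    (fun n => Real.le_sqrt_of_sq_le (H.sq_dist_le (by linarith))) h1

theorem cos_pos_of_lt {k : ℝ} (H : SphericalConvexity k X) {r : ℝ} (hr : 0 ≤ r)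
    (h : k * r < Real.pi / 2) : 0 < Real.cos (k * r) :=
  Real.cos_pos_of_mem_Ioo ⟨by linarith [mul_nonneg H.pos.le hr, Real.pi_pos], h⟩

theorem cos_le_of_dist_le {k : ℝ} (H : SphericalConvexity k X) {r : ℝ}
    (h : k * r < Real.pi / 2) {x y : X} (hxy : dist x y ≤ r) :
    Real.cos (k * r) ≤ Real.cos (k * dist x y) :=
  Real.cos_le_cos_of_nonneg_of_le_pi (H.nonneg x y) (by linarith [Real.pi_pos])
    (mul_le_mul_of_nonneg_left hxy H.pos.le)

section Iteration

variable [CompleteSpace X] {f : X → EReal} {v : X} {y : ℕ → X} {α lam : ℕ → ℝ}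

/-- Along the iteration, the distances to a minimizer stay bounded. -/
theorem cos_le_cos_iterate (H : SphericalConvexity (Real.sqrt κ) X) (hf_proper : IsProper f)
    (hf_lsc : LowerSemicontinuous f) (hf_convex : IsGeodesicallyConvex f)
    (hα : ∀ n, α n ∈ Set.Icc (0 : ℝ) 1) (hlam_pos : ∀ n, 0 < lam n)
    (hy : ∀ n, IsGeodesicCombination (α n) v (resolvent κ f (lam n) (y n)) (y (n + 1)))
    {p : X} (hp : p ∈ argmin f) (n : ℕ) :
    min (Real.cos (Real.sqrt κ * dist v p)) (Real.cos (Real.sqrt κ * dist (y 0) p))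
      ≤ Real.cos (Real.sqrt κ * dist (y n) p) := by
  have h0 : 0 ≤ min (Real.cos (Real.sqrt κ * dist v p)) (Real.cos (Real.sqrt κ * dist (y 0) p)) :=
    le_min (H.cos_pos _ _).le (H.cos_pos _ _).le
  induction n with
  | zero => exact min_le_right _ _
  | succ n ih =>
    refine H.le_cos_of_le (hα n) (hy n) h0 (min_le_left _ _) (ih.trans ?_)
    have := H.cos_le_cos_mul_cos_resolvent hf_proper hf_lsc hf_convex (hlam_pos n) (y n) hp
    rw [dist_comm (y n) p, dist_comm _ p]
    exact this.trans (mul_le_of_le_one_right (H.cos_pos _ _).le (Real.cos_le_one _))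

/-- If the resolvents stay uniformly close to the iterates, their values approach the infimum. -/
theorem eventually_resolvent_value_le (H : SphericalConvexity (Real.sqrt κ) X)
    (hf_proper : IsProper f) (hf_lsc : LowerSemicontinuous f) (hf_convex : IsGeodesicallyConvex f)
    (hlam_pos : ∀ n, 0 < lam n) (hlam : Tendsto lam atTop atTop) {c : ℝ} (hc : 0 < c)
    (hcy : ∀ n, c ≤ Real.cos (Real.sqrt κ * dist (resolvent κ f (lam n) (y n)) (y n)))
    {w : X} {t t' : ℝ} (hw : f w ≤ t) (htt' : t < t') :
    ∀ᶠ n in atTop, f (resolvent κ f (lam n) (y n)) ≤ t' := by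
  have h1 : Tendsto (fun n => t + 4 / c * (1 / lam n)) atTop (𝓝 t) := by
    have : Tendsto (fun n => 1 / lam n) atTop (𝓝 0) := by
      simpa [Function.comp_def] using tendsto_inv_atTop_zero.comp hlam
    simpa using (this.const_mul (4 / c)).const_add t
  filter_upwards [h1.eventually_le_const htt'] with n hn
  refine (H.resolvent_value_le hf_proper hf_lsc hf_convex (hlam_pos n) (y n) hc (hcy n) hw).trans ?_
  exact_mod_cast hn

/-- The resolvents themselves form a minimizing sequence lying eventually in one small ball, so
`exists_le_of_minimizing` applies. -/
theorem argmin_nonempty (H : SphericalConvexity (Real.sqrt κ) X)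
    (hf_proper : IsProper f) (hf_lsc : LowerSemicontinuous f) (hf_convex : IsGeodesicallyConvex f)
    (hlam_pos : ∀ n, 0 < lam n) (hlam : Tendsto lam atTop atTop) {c : ℝ} (hc : 0 < c)
    (hcy : ∀ n, c ≤ Real.cos (Real.sqrt κ * dist (resolvent κ f (lam n) (y n)) (y n)))
    (a : X) {r : ℝ} (hr : 0 < r)
    (ha : ∀ᶠ n in atTop, r ≤ Real.cos (Real.sqrt κ * dist (resolvent κ f (lam n) (y n)) a)) :
    (argmin f).Nonempty := by
  obtain ⟨B, hB⟩ := H.exists_lower_bound hf_proper hf_lsc hf_convex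
  obtain ⟨m, hm, hmin⟩ := exists_real_infimum hB hf_proper.2
  obtain ⟨p, hp, -⟩ := H.exists_le_of_minimizing (m := m) (fun c => hf_lsc.isClosed_preimage _)
    hf_convex.midpoint_le a hr (fun ε hε => by
      obtain ⟨w, hw⟩ := hmin (ε / 2) (by positivity)
      obtain ⟨n, hn, hn'⟩ := ((H.eventually_resolvent_value_le hf_proper hf_lsc hf_convex
        hlam_pos hlam hc hcy hw (t' := m + ε) (by linarith)).and ha).exists
      exact ⟨_, hn, hn'⟩)
  exact ⟨p, fun w => hp.trans (hm w)⟩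

/-- The resolvents eventually are not closer to `v` than the projection of `v`. -/
theorem eventually_cos_resolvent_lt (H : SphericalConvexity (Real.sqrt κ) X)
    (hf_proper : IsProper f) (hf_lsc : LowerSemicontinuous f) (hf_convex : IsGeodesicallyConvex f)
    (hlam_pos : ∀ n, 0 < lam n) (hlam : Tendsto lam atTop atTop) {c : ℝ} (hc : 0 < c)
    (hcy : ∀ n, c ≤ Real.cos (Real.sqrt κ * dist (resolvent κ f (lam n) (y n)) (y n)))
    {p : X} (hp : p ∈ nearestPoints (argmin f) v) {δ : ℝ} (hδ : 0 < δ) :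
    ∀ᶠ n in atTop, Real.cos (Real.sqrt κ * dist (resolvent κ f (lam n) (y n)) v)
      < Real.cos (Real.sqrt κ * dist p v) + δ := by
  obtain ⟨m, hm⟩ := argmin_finite hf_proper hp.1
  by_contra hcon
  have hfreq : ∃ᶠ n in atTop, Real.cos (Real.sqrt κ * dist p v) + δ
      ≤ Real.cos (Real.sqrt κ * dist (resolvent κ f (lam n) (y n)) v) := by
    simpa only [Filter.not_eventually, not_lt] using hcon
  -- Resolvents frequently nearer to `v` by a fixed margin would be a minimizing sequence in a
  -- smaller ball, producing a minimizer nearer to `v` than `p`.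
  obtain ⟨q, hq, hqv⟩ := H.exists_le_of_minimizing (m := m) (fun c => hf_lsc.isClosed_preimage _)
    hf_convex.midpoint_le v (add_pos (H.cos_pos p v) hδ) (fun ε hε => by
      obtain ⟨n, hn, hn'⟩ := (hfreq.and_eventually (H.eventually_resolvent_value_le hf_proper
        hf_lsc hf_convex hlam_pos hlam hc hcy hm.le (t' := m + ε) (by linarith))).exists
      exact ⟨_, hn', hn⟩)
  have hq' : q ∈ argmin f := fun w => hq.trans (hm ▸ hp.1 w)
  have h1 := hp.2 q hq'
  rw [dist_comm v p, dist_comm v q, ← H.cos_le_cos_iff] at h1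
  linarith

theorem tendsto_cos_iterate (H : SphericalConvexity (Real.sqrt κ) X) (hf_proper : IsProper f)
    (hf_lsc : LowerSemicontinuous f) (hf_convex : IsGeodesicallyConvex f)
    (hα : ∀ n, α n ∈ Set.Icc (0 : ℝ) 1) (hlam_pos : ∀ n, 0 < lam n)
    (hlam : Tendsto lam atTop atTop)
    (hy : ∀ n, IsGeodesicCombination (α n) v (resolvent κ f (lam n) (y n)) (y (n + 1)))
    {c : ℝ} (hc : 0 < c)
    (hcy : ∀ n, c ≤ Real.cos (Real.sqrt κ * dist (resolvent κ f (lam n) (y n)) (y n)))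
    (hα0 : Tendsto α atTop (𝓝 0))
    (hsum : Tendsto (fun N => ∑ n ∈ Finset.range N, α n ^ 2) atTop atTop)
    {p : X} (hp : p ∈ nearestPoints (argmin f) v) :
    Tendsto (fun n => Real.cos (Real.sqrt κ * dist (y n) p)) atTop (𝓝 1) := by
  set k := Real.sqrt κ
  set C := Real.cos (k * dist v p) with hC
  have hC0 : 0 < C := H.cos_pos v p
  have hC1 : C ≤ 1 := Real.cos_le_one _
  -- The margin ε absorbs both the size of α_n and the error in `eventually_cos_resolvent_lt`,
  -- leaving a homogeneous recursion.
  have hdefect : ∀ ε : ℝ, 0 < ε → ε < 1 →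
      Tendsto (fun n => max 0 (1 - ε - Real.cos (k * dist (y n) p))) atTop (𝓝 0) := by
    intro ε hε hε1
    have hδ : 0 < ε * C / 4 := by positivity
    refine tendsto_zero_of_le_one_sub_mul (b := fun n => α n ^ 2 / 2) (fun n => le_max_left _ _)
      ?_ ?_
    · filter_upwards [hα0.eventually_le_const hδ, H.eventually_cos_resolvent_lt hf_proper hf_lsc
        hf_convex hlam_pos hlam hc hcy hp hδ] with n hαn hcos
      set z := resolvent κ f (lam n) (y n)
      rw [dist_comm z v, dist_comm p v] at hcos
      have hcz : Real.cos (k * dist (y n) p) ≤ Real.cos (k * dist z p) := by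
        have := H.cos_le_cos_mul_cos_resolvent hf_proper hf_lsc hf_convex (hlam_pos n) (y n) hp.1
        rw [dist_comm (y n) p, dist_comm z p]
        exact this.trans (mul_le_of_le_one_right (H.cos_pos _ _).le (Real.cos_le_one _))
      have hα2 : 0 ≤ 1 - α n ^ 2 / 2 := by nlinarith [(hα n).1, (hα n).2]
      -- If z = v, the next iterate is v, and 1 < C + εC/4 already makes its defect vanish.
      rcases (dist_nonneg (x := v) (y := z)).eq_or_lt with h0 | hpos
      · rw [← h0, mul_zero, Real.cos_zero] at hcos
        rw [(hy n).eq_left h0.symm, max_eq_left]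
        · exact mul_nonneg hα2 (le_max_left _ _)
        · have : ε * C ≤ ε := mul_le_of_le_one_right hε.le hC1
          linarith
      · refine (spherical_halpern_step (hα n) (mul_pos H.pos hpos) (H.lt v z).le
          (H.le_cos _ _ _ _ p (hα n) (hy n))
          (cos_mul_le_of_cos_le (hα n).1 (H.nonneg v z) (H.lt v z).le hC0 hC1 hε hε1 hαn
            hcos.le)).trans ?_
        exact mul_le_mul_of_nonneg_left (max_le_max le_rfl (by linarith)) hα2
    · simp_rw [div_eq_mul_inv, ← Finset.sum_mul]
      exact hsum.atTop_mul_const (by norm_num)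
  refine tendsto_order.2 ⟨fun b hb => ?_, fun b hb => Eventually.of_forall fun n =>
    (Real.cos_le_one _).trans_lt hb⟩
  -- A defect below ε gives a cosine above 1 - 2ε ≥ b.
  have hε : 0 < min ((1 - b) / 2) (1 / 2) := lt_min (by linarith) (by norm_num)
  filter_upwards [(hdefect _ hε ((min_le_right _ _).trans_lt (by norm_num))).eventually_lt_const hε]
    with n hn
  have h1 := (le_max_right _ _).trans_lt hn
  have h2 := min_le_left ((1 - b) / 2) (1 / 2 : ℝ)
  linarith

end Iteration

end SphericalConvexity

end CATk

end

/-! ### The main theorem. -/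

theorem corollary6p2 {X : Type*} [MetricSpace X] [CompleteSpace X]
    (κ : ℝ) (hκ : 0 < κ) (hX : CATk.IsCATSpace κ X)
    (hdiam : ∀ w w' : X, dist w w' < CATk.D κ / 2)
    (f : X → EReal) (hf_proper : CATk.IsProper f) (hf_lsc : LowerSemicontinuous f)
    (hf_convex : CATk.IsGeodesicallyConvex f)
    (v : X) (y : ℕ → X) (α : ℕ → ℝ) (lam : ℕ → ℝ)
    (hα : ∀ n, α n ∈ Set.Icc (0 : ℝ) 1) (hlam_pos : ∀ n, 0 < lam n)
    (hlam : Tendsto lam atTop atTop)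
    (hy : ∀ n, CATk.IsGeodesicCombination (α n) v (CATk.resolvent κ f (lam n) (y n)) (y (n + 1))) :
    -- the resolvents are well defined
    (∀ η : ℝ, 0 < η → ∀ x : X,
      CATk.argmin (CATk.resolventObjective κ f η x) = {CATk.resolvent κ f η x}) ∧
    ((CATk.argmin f).Nonempty ↔
      (⨅ p : X, limsup (fun n => dist p (CATk.resolvent κ f (lam n) (y n))) atTop)
          < CATk.D κ / 2 ∧
        (⨆ n, dist (CATk.resolvent κ f (lam n) (y n)) (y n)) < CATk.D κ / 2) ∧
    ((CATk.argmin f).Nonempty → Tendsto α atTop (𝓝 0) →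
      Tendsto (fun N => ∑ n ∈ Finset.range N, α n ^ 2) atTop atTop →
      ∃ p : X, CATk.nearestPoints (CATk.argmin f) v = {p} ∧
        Tendsto y atTop (𝓝 p) ∧
        Tendsto (fun n => CATk.resolvent κ f (lam n) (y n)) atTop (𝓝 p)) := by
  have H := hX.sphericalConvexity hκ hdiam
  have hk := H.pos
  set z : ℕ → X := fun n => CATk.resolvent κ f (lam n) (y n) with hz
  have hD : Real.sqrt κ * (CATk.D κ / 2) = Real.pi / 2 := by
    unfold CATk.D; field_simp
  have hlt : ∀ {r : ℝ}, r < CATk.D κ / 2 → Real.sqrt κ * r < Real.pi / 2 := fun hr => by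
    rw [← hD]; exact mul_lt_mul_of_pos_left hr hk
  -- with a minimizer `p`, both sequences stay within a fixed distance below `D κ / 2`
  have hbound : ∀ p ∈ CATk.argmin f, ∃ M, 0 ≤ M ∧ M < CATk.D κ / 2 ∧
      (∀ n, dist p (z n) ≤ M) ∧ ∀ n, dist (z n) (y n) ≤ M := by
    intro p hp
    have hcos : ∀ n, Real.cos (Real.sqrt κ * dist (y n) p)
        ≤ Real.cos (Real.sqrt κ * dist p (z n)) * Real.cos (Real.sqrt κ * dist (z n) (y n)) := by
      intro n
      rw [dist_comm (y n) p]
      exact H.cos_le_cos_mul_cos_resolvent hf_proper hf_lsc hf_convex (hlam_pos n) (y n) hp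
    have hyM : ∀ n, dist (y n) p ≤ max (dist v p) (dist (y 0) p) := by
      intro n
      rcases min_le_iff.1
        (H.cos_le_cos_iterate hf_proper hf_lsc hf_convex hα hlam_pos hy hp n) with h | h
      · exact le_max_of_le_left (H.cos_le_cos_iff.1 h)
      · exact le_max_of_le_right (H.cos_le_cos_iff.1 h)
    refine ⟨max (dist v p) (dist (y 0) p), le_max_of_le_left dist_nonneg,
      max_lt (hdiam _ _) (hdiam _ _), fun n => le_trans ?_ (hyM n), fun n => le_trans ?_ (hyM n)⟩
    · exact H.cos_le_cos_iff.1 ((hcos n).trans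
        (mul_le_of_le_one_right (H.cos_pos _ _).le (Real.cos_le_one _)))
    · exact H.cos_le_cos_iff.1 ((hcos n).trans
        (mul_le_of_le_one_left (H.cos_pos _ _).le (Real.cos_le_one _)))
  -- The infimum, limsup and supremum are taken in ℝ, with default values on unbounded families; the
  -- diameter bound makes them genuine.
  have hbddAbove : ∀ q : X, IsBoundedUnder (· ≤ ·) atTop fun n => dist q (z n) := fun q =>
    isBoundedUnder_of ⟨CATk.D κ / 2, fun n => (hdiam _ _).le⟩
  have hbddBelow : ∀ q : X, IsBoundedUnder (· ≥ ·) atTop fun n => dist q (z n) := fun q =>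
    isBoundedUnder_of ⟨0, fun n => dist_nonneg⟩
  refine ⟨fun η hη x => H.argmin_resolventObjective hf_proper hf_lsc hf_convex hη x,
    ⟨?_, ?_⟩, ?_⟩
  · rintro ⟨p, hp⟩
    obtain ⟨M, -, hMD, hM1, hM2⟩ := hbound p hp
    constructor
    · refine lt_of_le_of_lt (ciInf_le ⟨0, ?_⟩ p) (lt_of_le_of_lt ?_ hMD)
      · rintro _ ⟨q, rfl⟩
        exact le_limsup_of_frequently_le (Frequently.of_forall fun n => dist_nonneg)
          (hbddAbove q)
      · exact limsup_le_of_le (hbddBelow p).isCoboundedUnder_le (Eventually.of_forall hM1)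
    · exact (ciSup_le hM2).trans_lt hMD
  · rintro ⟨hinf, hsup⟩
    have : Nonempty X := ⟨v⟩
    obtain ⟨a, ha⟩ := exists_lt_of_ciInf_lt hinf
    obtain ⟨r, har, hrD⟩ := exists_between ha
    have hev := eventually_lt_of_limsup_lt har (hbddAbove a)
    have hr0 : 0 ≤ r := by
      obtain ⟨n, hn⟩ := hev.exists
      exact dist_nonneg.trans hn.le
    have hle : ∀ n, dist (z n) (y n) ≤ ⨆ n, dist (z n) (y n) := fun n =>
      le_ciSup (f := fun n => dist (z n) (y n))
        ⟨CATk.D κ / 2, by rintro _ ⟨n, rfl⟩; exact (hdiam _ _).le⟩ n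
    refine H.argmin_nonempty hf_proper hf_lsc hf_convex hlam_pos hlam
      (H.cos_pos_of_lt (dist_nonneg.trans (hle 0)) (hlt hsup))
      (fun n => H.cos_le_of_dist_le (hlt hsup) (hle n)) a (H.cos_pos_of_lt hr0 (hlt hrD)) ?_
    filter_upwards [hev] with n hn
    exact H.cos_le_of_dist_le (hlt hrD) (by rw [dist_comm]; exact hn.le)
  · rintro hne hα0 hsum
    obtain ⟨p₀, hp₀⟩ := hne
    obtain ⟨m, hm⟩ := CATk.argmin_finite hf_proper hp₀
    -- As a sublevel set, the set of minimizers is closed and midpoint-convex.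
    have hargmin : CATk.argmin f = {x | f x ≤ m} := by
      ext x
      exact ⟨fun hx => hm ▸ hx p₀, fun hx w => le_trans (show f x ≤ m from hx) (hm ▸ hp₀ w)⟩
    obtain ⟨p, hp⟩ := H.exists_nearestPoints_eq_singleton (C := CATk.argmin f) ⟨p₀, hp₀⟩
      (hargmin ▸ hf_lsc.isClosed_preimage _)
      (by
        rw [hargmin]
        exact fun x hx y hy z hz => hf_convex.midpoint_le m x y z hx hy hz) v
    have hpmem : p ∈ CATk.nearestPoints (CATk.argmin f) v := hp ▸ rfl
    obtain ⟨M, hM0, hMD, -, hM⟩ := hbound p hpmem.1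
    have hcosy := H.tendsto_cos_iterate hf_proper hf_lsc hf_convex hα hlam_pos hlam hy
      (H.cos_pos_of_lt hM0 (hlt hMD)) (fun n => H.cos_le_of_dist_le (hlt hMD) (hM n)) hα0 hsum
      hpmem
    refine ⟨p, hp, H.tendsto_of_tendsto_cos hcosy, H.tendsto_of_tendsto_cos ?_⟩
    -- The resolvent is at least as close to `p` as the iterate.
    refine tendsto_of_tendsto_of_tendsto_of_le_of_le hcosy tendsto_const_nhds (fun n => ?_)
      (fun n => Real.cos_le_one _)
    have := H.cos_le_cos_mul_cos_resolvent hf_proper hf_lsc hf_convex (hlam_pos n) (y n) hpmem.1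
    change Real.cos (Real.sqrt κ * dist (y n) p) ≤ Real.cos (Real.sqrt κ * dist (z n) p)
    rw [dist_comm (y n) p, dist_comm (z n) p]
    exact this.trans (mul_le_of_le_one_right (H.cos_pos _ _).le (Real.cos_le_one _))
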